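/- Let $n\ge 1$ and $m\ge 0$ be integers and let $\alpha>-1$ be real. Write $\langle z,w\rangle=\sum_{i=1}^n z_i\overline{w_i}$ and $|z|^2=\langle z,z\rangle$ on $\mathbb{C}^n$, let $\mathbb{B}^n=\{z\in\mathbb{C}^n:|z|<1\}$, let $\lambda$ be Lebesgue measure, and for functions on $\mathbb{B}^n$ put $$\langle f,g\rangle_\alpha=\int_{\mathbb{B}^n} f(z)\overline{g(z)}\,(1-|z|^2)^\alpha\,d\lambda(z),\qquad \|f\|_\alpha^2=\int_{\mathbb{B}^n} |f(z)|^2(1-|z|^2)^\alpha\,d\lambda(z)\in[0,\infty].$$ For a multi-index $p=(p_1,\dots,p_n)$ of nonnegative integers let $|p|=p_1+\cdots+p_n$, $p!=p_1!\cdots p_n!$, $z^p=z_1^{p_1}\cdots z_n^{p_n}$ and $D^p=\partial^{|p|}/\partial z_1^{p_1}\cdots\partial z_n^{p_n}$. For a holomorphic function $f$ on $\mathbb{B}^n$ with Taylor expansion $f(z)=\sum_p a_pz^p$ at the origin, write $f=f_{1,m}+f_{2,m}$ with $f_{1,m}(z)=\sum_{|p|<m}a_pz^p$, and put $$\|f\|_{\alpha,m}^2=\|f_{1,m}\|_\alpha^2+m!\sum_{|p|=m}\frac1{p!}\|D^pf_{2,m}\|_\alpha^2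 ,\qquad \langle f,g\rangle_{\alpha,m}=\langle f_{1,m},g_{1,m}\rangle_\alpha+m!\sum_{|p|=m}\frac1{p!}\langle D^pf_{2,m},D^pg_{2,m}\rangle_\alpha .$$ **Theorem.** The space of all holomorphic functions $f$ on $\mathbb{B}^n$ with $\|f\|_{\alpha,m}<\infty$ (the generalized Bergman–Dirichlet space of order $m$), with the inner product $\langle\cdot,\cdot\rangle_{\alpha,m}$ and the norm $\|\cdot\|_{\alpha,m}$, is a Hilbert space in which all point evaluations $f\mapsto f(z)$, $z\in\mathbb{B}^n$, are continuous, that is, a reproducing kernel Hilbert space. Its reproducing kernel is, for $z,w\in\mathbb{B}^n$, $$K(z,w)=\frac{\Gamma(\alpha+n+1)}{\pi^n\,\Gamma(\alpha+1)}\left[\sum_{k<m}(\alpha+n+1)_k\frac{\langle z,w\rangle^k}{k!}+\frac{\langle z,w\rangle^m}{(m!)^2}\;{}_3F_2\!\left(\begin{matrix}1,\,1,\,\alpha+n+1\\ m+1,\,m+1\end{matrix}\,\Big|\,\langle z,w\rangle\right)\right],$$ where $(a)_k=a(a+1)\cdots(a+k-1)$ and $${}_3F_2\!\left(\begin{matrix}a_1,a_2,a_3\\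 b_1,b_2\end{matrix}\,\Big|\,x\right)=\sum_{k\ge0}\frac{(a_1)_k(a_2)_k(a_3)_k}{(b_1)_k(b_2)_k}\frac{x^k}{k!},$$ a series that converges at $x=\langle z,w\rangle$ for all $z,w\in\mathbb{B}^n$. -/

import Mathlib

open MeasureTheory Set
open scoped ENNReal Nat ComplexConjugate

noncomputable section

namespace BergmanDirichlet

/-- The open unit ball `|z₁|² + ⋯ + |zₙ|² < 1` of `ℂⁿ`. -/
def unitBall (n : ℕ) : Set (Fin n → ℂ) := {z | ∑ i, ‖z i‖ ^ 2 < 1}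

/-- The Hermitian product `⟨z, w⟩ = ∑ᵢ zᵢ w̄ᵢ` of `ℂⁿ`. -/
def scal {n : ℕ} (z w : Fin n → ℂ) : ℂ := ∑ i, z i * conj (w i)

/-- The weighted Lebesgue measure `(1 - |z|²)^α dλ(z)` on the unit ball. -/
def weightedMeasure (n : ℕ) (α : ℝ) : Measure (Fin n → ℂ) :=
  (volume.restrict (unitBall n)).withDensity
    fun z => ENNReal.ofReal ((1 - ∑ i, ‖z i‖ ^ 2) ^ α)

/-- The partial derivative `∂F/∂zᵢ`. -/
def pderiv {n : ℕ} (i : Fin n) (F : (Fin n → ℂ) → ℂ) : (Fin n → ℂ) → ℂ :=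
  fun z => lineDeriv ℂ F z (Pi.single i 1)

/-- The operator `D^p = ∂^{|p|} / ∂z₁^{p₁} ⋯ ∂zₙ^{pₙ}`. -/
def partialD {n : ℕ} (p : Fin n → ℕ) (F : (Fin n → ℂ) → ℂ) : (Fin n → ℂ) → ℂ :=
  (List.finRange n).foldr (fun i G => (pderiv i)^[p i] G) F

/-- The multi-indices `p` of length `n` with `|p| = p₁ + ⋯ + pₙ = k`. -/
def multiIndices (n k : ℕ) : Finset (Fin n → ℕ) := Finset.piAntidiag Finset.univ k

/-- `p! = p₁! ⋯ pₙ!`. -/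
def multiFactorial {n : ℕ} (p : Fin n → ℕ) : ℕ := ∏ i, (p i)!

/-- The Taylor coefficient of `z^p` of `F` at the origin, `D^p F(0) / p!`. -/
def taylorCoeff {n : ℕ} (F : (Fin n → ℂ) → ℂ) (p : Fin n → ℕ) : ℂ :=
  partialD p F 0 / (multiFactorial p : ℂ)

/-- `F₁,ₘ(z) = ∑_{|p| < m} a_p z^p`, the part of degree `< m` of the Taylor expansion of `F`. -/
def taylorHead {n : ℕ} (m : ℕ) (F : (Fin n → ℂ) → ℂ) : (Fin n → ℂ) → ℂ :=
  fun z => ∑ k ∈ Finset.range m, ∑ p ∈ multiIndices n k, taylorCoeff F p * ∏ i, z i ^ p i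

/-- The remainder `F₂,ₘ = F - F₁,ₘ`. -/
def taylorTail {n : ℕ} (m : ℕ) (F : (Fin n → ℂ) → ℂ) : (Fin n → ℂ) → ℂ :=
  fun z => F z - taylorHead m F z

/-- The square `‖F‖_α² ∈ [0, ∞]` of the weighted Bergman norm. -/
def bergmanNormSq {n : ℕ} (α : ℝ) (F : (Fin n → ℂ) → ℂ) : ℝ≥0∞ :=
  ∫⁻ z, ‖F z‖ₑ ^ 2 ∂(weightedMeasure n α)

/-- The weighted Bergman inner product `⟨F, G⟩_α`, linear in `F`. -/
def bergmanInner {n : ℕ} (α : ℝ) (F G : (Fin n → ℂ) → ℂ) : ℂ :=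
  ∫ z, F z * conj (G z) ∂(weightedMeasure n α)

/-- `‖F‖_{α,m}² = ‖F₁,ₘ‖_α² + m! ∑_{|p| = m} (1/p!) ‖D^p F₂,ₘ‖_α² ∈ [0, ∞]`. -/
def normSq {n : ℕ} (m : ℕ) (α : ℝ) (F : (Fin n → ℂ) → ℂ) : ℝ≥0∞ :=
  bergmanNormSq α (taylorHead m F) +
    (m ! : ℝ≥0∞) * ∑ p ∈ multiIndices n m,
      (multiFactorial p : ℝ≥0∞)⁻¹ * bergmanNormSq α (partialD p (taylorTail m F))

/-- `⟨F, G⟩_{α,m} = ⟨F₁,ₘ, G₁,ₘ⟩_α + m! ∑_{|p| = m} (1/p!) ⟨D^p F₂,ₘ, D^p G₂,ₘ⟩_α`,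
linear in `F`. -/
def innerProd {n : ℕ} (m : ℕ) (α : ℝ) (F G : (Fin n → ℂ) → ℂ) : ℂ :=
  bergmanInner α (taylorHead m F) (taylorHead m G) +
    (m ! : ℂ) * ∑ p ∈ multiIndices n m,
      (multiFactorial p : ℂ)⁻¹ *
        bergmanInner α (partialD p (taylorTail m F)) (partialD p (taylorTail m G))

/-- A function on the ball, continued by `0` to `ℂⁿ`. As the ball is open, the derivatives of the
continuation at the points of the ball are those of the function. -/
def zeroExt {n : ℕ} (f : unitBall n → ℂ) : (Fin n → ℂ) → ℂ := Function.extend Subtype.val f 0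

/-- A function on the ball is holomorphic if near each point of the ball it is the sum of a
convergent power series in `n` complex variables. -/
def IsHolomorphic {n : ℕ} (f : unitBall n → ℂ) : Prop :=
  AnalyticOnNhd ℂ (zeroExt f) (unitBall n)

/-! ### The holomorphic functions of finite norm form a vector space -/

lemma isOpen_unitBall (n : ℕ) : IsOpen (unitBall n) :=
  isOpen_lt (by fun_prop) continuous_const

/-- Operators which are linear on holomorphic functions and local on the ball. -/
structure IsLocalLinear {n : ℕ} (T : ((Fin n → ℂ) → ℂ) → ((Fin n → ℂ) → ℂ)) : Prop where
  analytic : ∀ F, AnalyticOnNhd ℂ F (unitBall n) → AnalyticOnNhd ℂ (T F) (unitBall n)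
  local_eq : ∀ F G, EqOn F G (unitBall n) → EqOn (T F) (T G) (unitBall n)
  add : ∀ F G, AnalyticOnNhd ℂ F (unitBall n) → AnalyticOnNhd ℂ G (unitBall n) →
    EqOn (T (F + G)) (T F + T G) (unitBall n)
  smul : ∀ (c : ℂ) F, AnalyticOnNhd ℂ F (unitBall n) → EqOn (T (c • F)) (c • T F) (unitBall n)

lemma IsLocalLinear.id {n : ℕ} : IsLocalLinear (fun F : (Fin n → ℂ) → ℂ => F) :=
  ⟨fun _ h => h, fun _ _ h => h, fun _ _ _ _ => eqOn_refl _ _, fun _ _ _ => eqOn_refl _ _⟩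

lemma IsLocalLinear.comp {n : ℕ} {S T : ((Fin n → ℂ) → ℂ) → ((Fin n → ℂ) → ℂ)}
    (hS : IsLocalLinear S) (hT : IsLocalLinear T) : IsLocalLinear (fun F => S (T F)) where
  analytic F h := hS.analytic _ (hT.analytic _ h)
  local_eq F G h := hS.local_eq _ _ (hT.local_eq _ _ h)
  add F G hF hG := (hS.local_eq _ _ (hT.add F G hF hG)).trans
    (hS.add _ _ (hT.analytic _ hF) (hT.analytic _ hG))
  smul c F hF := (hS.local_eq _ _ (hT.smul c F hF)).trans (hS.smul c _ (hT.analytic _ hF))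

lemma isLocalLinear_pderiv {n : ℕ} (i : Fin n) : IsLocalLinear (pderiv i) where
  analytic F h := by
    have h1 : AnalyticOnNhd ℂ (fun z => fderiv ℂ F z (Pi.single i 1)) (unitBall n) :=
      fun z hz => ((ContinuousLinearMap.apply ℂ ℂ (Pi.single i 1 : Fin n → ℂ)).analyticAt _).comp
        (h.fderiv z hz)
    exact h1.congr (isOpen_unitBall n)
      fun z hz => ((h z hz).differentiableAt.lineDeriv_eq_fderiv).symm
  local_eq F G h z hz := by
    have : F =ᶠ[nhds z] G := Filter.eventuallyEq_of_mem ((isOpen_unitBall n).mem_nhds hz) h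
    exact this.lineDeriv_eq
  add F G hF hG z hz := by
    have h1 := (hF z hz).differentiableAt
    have h2 := (hG z hz).differentiableAt
    simp only [pderiv, Pi.add_apply]
    rw [(h1.add h2).lineDeriv_eq_fderiv, h1.lineDeriv_eq_fderiv, h2.lineDeriv_eq_fderiv,
      fderiv_add h1 h2]
    rfl
  smul c F hF z hz := by
    have h1 := (hF z hz).differentiableAt
    simp only [pderiv, Pi.smul_apply]
    rw [(h1.const_smul c).lineDeriv_eq_fderiv, h1.lineDeriv_eq_fderiv, fderiv_const_smul h1]
    rfl

lemma isLocalLinear_partialD {n : ℕ} (p : Fin n → ℕ) : IsLocalLinear (partialD p) := by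
  have iter : ∀ (i : Fin n) (k : ℕ), IsLocalLinear ((pderiv i)^[k]) := by
    intro i k
    induction k with
    | zero => exact IsLocalLinear.id
    | succ k ih =>
      have : (pderiv i)^[k + 1] = fun F => (pderiv i)^[k] (pderiv i F) := rfl
      rw [this]
      exact ih.comp (isLocalLinear_pderiv i)
  have : ∀ l : List (Fin n),
      IsLocalLinear (fun F => l.foldr (fun i G => (pderiv i)^[p i] G) F) := by
    intro l
    induction l with
    | nil => exact IsLocalLinear.id
    | cons i l ih => exact (iter i (p i)).comp ih
  exact this _

lemma zero_mem_unitBall (n : ℕ) : (0 : Fin n → ℂ) ∈ unitBall n := by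
  simp [unitBall]

lemma isLocalLinear_taylorHead {n : ℕ} (m : ℕ) :
    IsLocalLinear (taylorHead (n := n) m) where
  analytic F _ z _ := by
    unfold taylorHead
    refine Finset.analyticAt_fun_sum _ fun k _ => Finset.analyticAt_fun_sum _ fun p _ => ?_
    refine analyticAt_const.mul (Finset.analyticAt_fun_prod _ fun i _ => ?_)
    have h1 : AnalyticAt ℂ (fun z : Fin n → ℂ => z i) z :=
      ContinuousLinearMap.analyticAt (ContinuousLinearMap.proj i : (Fin n → ℂ) →L[ℂ] ℂ) z
    exact h1.pow _
  local_eq F G h z _ := by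
    simp only [taylorHead, taylorCoeff]
    refine Finset.sum_congr rfl fun k _ => Finset.sum_congr rfl fun p _ => ?_
    rw [(isLocalLinear_partialD p).local_eq F G h (zero_mem_unitBall n)]
  add F G hF hG z _ := by
    simp only [taylorHead, taylorCoeff, Pi.add_apply, ← Finset.sum_add_distrib]
    refine Finset.sum_congr rfl fun k _ => Finset.sum_congr rfl fun p _ => ?_
    rw [(isLocalLinear_partialD p).add F G hF hG (zero_mem_unitBall n), Pi.add_apply]
    ring
  smul c F hF z _ := by
    simp only [taylorHead, taylorCoeff, Pi.smul_apply, smul_eq_mul, Finset.mul_sum]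
    refine Finset.sum_congr rfl fun k _ => Finset.sum_congr rfl fun p _ => ?_
    rw [(isLocalLinear_partialD p).smul c F hF (zero_mem_unitBall n), Pi.smul_apply, smul_eq_mul]
    ring

lemma isLocalLinear_taylorTail {n : ℕ} (m : ℕ) :
    IsLocalLinear (taylorTail (n := n) m) where
  analytic F h := h.sub ((isLocalLinear_taylorHead m).analytic F h)
  local_eq F G h z hz := by
    simp only [taylorTail]
    rw [h hz, (isLocalLinear_taylorHead m).local_eq F G h hz]
  add F G hF hG z hz := by
    simp only [taylorTail, Pi.add_apply]
    rw [(isLocalLinear_taylorHead m).add F G hF hG hz, Pi.add_apply]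
    ring
  smul c F hF z hz := by
    simp only [taylorTail, Pi.smul_apply, smul_eq_mul]
    rw [(isLocalLinear_taylorHead m).smul c F hF hz, Pi.smul_apply, smul_eq_mul]
    ring

lemma ae_mem_unitBall (n : ℕ) (α : ℝ) : ∀ᵐ z ∂(weightedMeasure n α), z ∈ unitBall n :=
  (withDensity_absolutelyContinuous _ _).ae_le
    (ae_restrict_mem (isOpen_unitBall n).measurableSet)

lemma bergmanNormSq_add_le {n : ℕ} (α : ℝ) {T : ((Fin n → ℂ) → ℂ) → ((Fin n → ℂ) → ℂ)}
    (hT : IsLocalLinear T) {F G : (Fin n → ℂ) → ℂ} (hF : AnalyticOnNhd ℂ F (unitBall n))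
    (hG : AnalyticOnNhd ℂ G (unitBall n)) :
    bergmanNormSq α (T (F + G)) ≤ 2 * (bergmanNormSq α (T F) + bergmanNormSq α (T G)) := by
  have hm : AEMeasurable (T F) (weightedMeasure n α) :=
    (((hT.analytic F hF).continuousOn).aemeasurable
      (isOpen_unitBall n).measurableSet).mono_ac (withDensity_absolutelyContinuous _ _)
  unfold bergmanNormSq
  rw [← lintegral_add_left' (hm.enorm.pow_const 2), ← lintegral_const_mul' _ _ (by simp)]
  refine lintegral_mono_ae ?_
  filter_upwards [ae_mem_unitBall n α] with z hz
  rw [hT.add F G hF hG hz, Pi.add_apply]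
  calc ‖T F z + T G z‖ₑ ^ 2 ≤ (‖T F z‖ₑ + ‖T G z‖ₑ) ^ 2 := by gcongr; exact enorm_add_le _ _
    _ ≤ 2 * (‖T F z‖ₑ ^ 2 + ‖T G z‖ₑ ^ 2) := by
      have := ENNReal.rpow_add_le_mul_rpow_add_rpow ‖T F z‖ₑ ‖T G z‖ₑ (p := 2) (by norm_num)
      norm_num at this
      exact_mod_cast this

lemma bergmanNormSq_smul {n : ℕ} (α : ℝ) {T : ((Fin n → ℂ) → ℂ) → ((Fin n → ℂ) → ℂ)}
    (hT : IsLocalLinear T) {F : (Fin n → ℂ) → ℂ} (hF : AnalyticOnNhd ℂ F (unitBall n)) (c : ℂ) :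
    bergmanNormSq α (T (c • F)) = ‖c‖ₑ ^ 2 * bergmanNormSq α (T F) := by
  unfold bergmanNormSq
  rw [← lintegral_const_mul' _ _ (by simp)]
  refine lintegral_congr_ae ?_
  filter_upwards [ae_mem_unitBall n α] with z hz
  rw [hT.smul c F hF hz, Pi.smul_apply, enorm_smul, mul_pow]

lemma normSq_add_le {n : ℕ} (m : ℕ) (α : ℝ) {F G : (Fin n → ℂ) → ℂ}
    (hF : AnalyticOnNhd ℂ F (unitBall n)) (hG : AnalyticOnNhd ℂ G (unitBall n)) :
    normSq m α (F + G) ≤ 2 * (normSq m α F + normSq m α G) := by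
  unfold normSq
  calc _ ≤ 2 * (bergmanNormSq α (taylorHead m F) + bergmanNormSq α (taylorHead m G)) +
        (m ! : ℝ≥0∞) * ∑ p ∈ multiIndices n m, (multiFactorial p : ℝ≥0∞)⁻¹ *
          (2 * (bergmanNormSq α (partialD p (taylorTail m F)) +
            bergmanNormSq α (partialD p (taylorTail m G)))) := by
        gcongr with p hp
        · exact bergmanNormSq_add_le α (isLocalLinear_taylorHead m) hF hG
        · exact bergmanNormSq_add_le α
            ((isLocalLinear_partialD p).comp (isLocalLinear_taylorTail m)) hF hG
    _ = _ := by
        simp only [mul_add, Finset.mul_sum, Finset.sum_add_distrib]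
        simp only [mul_left_comm _ (2 : ℝ≥0∞)]
        ring

lemma normSq_smul {n : ℕ} (m : ℕ) (α : ℝ) {F : (Fin n → ℂ) → ℂ}
    (hF : AnalyticOnNhd ℂ F (unitBall n)) (c : ℂ) :
    normSq m α (c • F) = ‖c‖ₑ ^ 2 * normSq m α F := by
  unfold normSq
  rw [bergmanNormSq_smul α (isLocalLinear_taylorHead m) hF, mul_add]
  congr 1
  rw [mul_left_comm, Finset.mul_sum (a := ‖c‖ₑ ^ 2)]
  congr 1
  refine Finset.sum_congr rfl fun p _ => ?_
  rw [bergmanNormSq_smul α ((isLocalLinear_partialD p).comp (isLocalLinear_taylorTail m)) hF,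
    mul_left_comm]

lemma zeroExt_add {n : ℕ} (f g : unitBall n → ℂ) : zeroExt (f + g) = zeroExt f + zeroExt g := by
  have := Function.extend_add (Subtype.val : unitBall n → _) f g 0 0
  rwa [add_zero] at this

lemma zeroExt_smul {n : ℕ} (c : ℂ) (f : unitBall n → ℂ) : zeroExt (c • f) = c • zeroExt f := by
  have := Function.extend_smul c (Subtype.val : unitBall n → _) f 0
  rwa [smul_zero] at this

lemma zeroExt_zero {n : ℕ} : zeroExt (0 : unitBall n → ℂ) = 0 := Function.extend_zero _

/-- The holomorphic functions `f` on the ball with `‖f‖_{α,m} < ∞`, as a linear subspace of the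
functions on the ball. -/
def holSubmodule (n m : ℕ) (α : ℝ) : Submodule ℂ (unitBall n → ℂ) where
  carrier := {f | IsHolomorphic f ∧ normSq m α (zeroExt f) < ∞}
  add_mem' := by
    rintro f g ⟨hf, hf'⟩ ⟨hg, hg'⟩
    simp only [mem_ofPred_eq, IsHolomorphic, zeroExt_add]
    exact ⟨hf.add hg, (normSq_add_le m α hf hg).trans_lt
      (ENNReal.mul_lt_top (by simp) (ENNReal.add_lt_top.2 ⟨hf', hg'⟩))⟩
  zero_mem' := by
    have h0 : AnalyticOnNhd ℂ (0 : (Fin n → ℂ) → ℂ) (unitBall n) := analyticOnNhd_const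
    simp only [mem_ofPred_eq, IsHolomorphic, zeroExt_zero]
    refine ⟨h0, ?_⟩
    have := normSq_smul m α h0 0
    simp only [smul_zero, enorm_zero] at this
    rw [this]
    simp
  smul_mem' := by
    rintro c f ⟨hf, hf'⟩
    simp only [mem_ofPred_eq, IsHolomorphic, zeroExt_smul]
    refine ⟨hf.const_smul, ?_⟩
    rw [normSq_smul m α hf]
    exact ENNReal.mul_lt_top (by simp) hf'

/-- The generalized Bergman–Dirichlet space of order `m` on the unit ball of `ℂⁿ`, as a vector
space. It is a type of its own, so that it does not inherit the topology of pointwise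
convergence. -/
def Space (n m : ℕ) (α : ℝ) : Type := holSubmodule n m α

instance (n m : ℕ) (α : ℝ) : AddCommGroup (Space n m α) :=
  inferInstanceAs (AddCommGroup (holSubmodule n m α))

instance (n m : ℕ) (α : ℝ) : Module ℂ (Space n m α) :=
  inferInstanceAs (Module ℂ (holSubmodule n m α))

/-- The function on the ball that an element of the space is. -/
def Space.toFun {n m : ℕ} {α : ℝ} (f : Space n m α) : unitBall n → ℂ := f.1

/-- The general term of the hypergeometric series
`∑ₖ (a₁)ₖ (a₂)ₖ (a₃)ₖ / ((b₁)ₖ (b₂)ₖ) xᵏ / k!`. -/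
def hypTerm (a₁ a₂ a₃ b₁ b₂ x : ℂ) (k : ℕ) : ℂ :=
  (ascPochhammer ℂ k).eval a₁ * (ascPochhammer ℂ k).eval a₂ * (ascPochhammer ℂ k).eval a₃ /
    ((ascPochhammer ℂ k).eval b₁ * (ascPochhammer ℂ k).eval b₂) * (x ^ k / (k ! : ℂ))

/-- The hypergeometric function `₃F₂(a₁, a₂, a₃; b₁, b₂ | x)`. -/
def hyp3F2 (a₁ a₂ a₃ b₁ b₂ x : ℂ) : ℂ := ∑' k, hypTerm a₁ a₂ a₃ b₁ b₂ x k

/-- `Γ(α+n+1) / (πⁿ Γ(α+1))` times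
`∑_{k<m} (α+n+1)ₖ ⟨z,w⟩ᵏ / k! + ⟨z,w⟩ᵐ / (m!)² ₃F₂(1, 1, α+n+1; m+1, m+1 | ⟨z,w⟩)`. -/
def kernelFormula (n m : ℕ) (α : ℝ) (z w : Fin n → ℂ) : ℂ :=
  ((Real.Gamma (α + n + 1) / (Real.pi ^ n * Real.Gamma (α + 1)) : ℝ) : ℂ) *
    (∑ k ∈ Finset.range m,
        (ascPochhammer ℂ k).eval ((α : ℂ) + n + 1) * (scal z w ^ k / (k ! : ℂ)) +
      scal z w ^ m / (m ! : ℂ) ^ 2 *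
        hyp3F2 1 1 ((α : ℂ) + n + 1) ((m : ℂ) + 1) ((m : ℂ) + 1) (scal z w))

end BergmanDirichlet

end

noncomputable section

namespace BergmanDirichlet

/-! The monomials are orthogonal for `⟨·,·⟩_{α,m}`, and `‖z^p‖² = p! · weight |p|`. The norm is
therefore a weighted `ℓ²` norm of the Taylor coefficients, and multiplying each coefficient by
`‖z^p‖` identifies the space with `ℓ²` over the multi-indices.

Four facts carry this. A function holomorphic on the ball is the sum of its power series on the
whole ball (`exists_hasExpansion`). The weight and Lebesgue measure are invariant under the torus
acting on the coordinates, so averaging over the torus gives Parseval's identity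
(`HasExpansion.bergmanNormSq_eq`). The integrals of `|z^p|²` are products of Beta integrals
(`lintegral_ballIntegrand`). Finally `m! ∑_{|q|=m} ‖D^q z^r‖² / q!` collapses, by Vandermonde's
identity, to `r!` times a factor that depends on `|r|` only (`HasExpansion.normSq_eq`).

Every square summable family comes from a function (`coeffMap_surjective`), which gives
completeness. Evaluation at `z` is the inner product with the family `conj (z^p) / ‖z^p‖`, and this
family is square summable. Hence the kernel is `∑ z^p conj (w^p) / ‖z^p‖²`. By the multinomial
theorem it equals `∑ₖ ⟨z,w⟩ᵏ / (k! · weight k)`, whose Gamma quotients are the Pochhammer symbols of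
the formula. -/

/-! ### Multiple power series on the ball and their derivatives. -/

/-- The monomial `z^p`. -/
def monomial {n : ℕ} (p : Fin n → ℕ) (z : Fin n → ℂ) : ℂ := ∏ i, z i ^ p i

/-- The power series `∑ₚ aₚ zᵖ` converges (absolutely) to `F` on the ball. -/
def HasExpansion {n : ℕ} (F : (Fin n → ℂ) → ℂ) (a : (Fin n → ℕ) → ℂ) : Prop :=
  ∀ z ∈ unitBall n, HasSum (fun p => a p * monomial p z) (F z)

lemma hasSum_of_forall_eq {ι : Type*} {f g : ι → ℂ} {s : ℂ} (h : HasSum f s)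
    (e : ∀ x, g x = f x) : HasSum g s :=
  (funext e : g = f) ▸ h

lemma mem_unitBall {n : ℕ} {z : Fin n → ℂ} : z ∈ unitBall n ↔ ∑ i, ‖z i‖ ^ 2 < 1 := Iff.rfl

lemma mem_unitBall_of_le {n : ℕ} {z w : Fin n → ℂ} (hw : w ∈ unitBall n)
    (h : ∀ i, ‖z i‖ ≤ ‖w i‖) : z ∈ unitBall n := by
  refine lt_of_le_of_lt (Finset.sum_le_sum fun i _ => ?_) (mem_unitBall.1 hw)
  gcongr
  exact h i

lemma norm_monomial {n : ℕ} (p : Fin n → ℕ) (z : Fin n → ℂ) :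
    ‖monomial p z‖ = ∏ i, ‖z i‖ ^ p i := by
  simp [monomial, norm_prod, norm_pow]

lemma norm_monomial_le {n : ℕ} (p : Fin n → ℕ) {z w : Fin n → ℂ} (h : ∀ i, ‖z i‖ ≤ ‖w i‖) :
    ‖monomial p z‖ ≤ ‖monomial p w‖ := by
  rw [norm_monomial, norm_monomial]
  gcongr with i
  exact h i

lemma monomial_mul {n : ℕ} (p : Fin n → ℕ) (z w : Fin n → ℂ) :
    monomial p (z * w) = monomial p z * monomial p w := by
  simp [monomial, mul_pow, Finset.prod_mul_distrib]

lemma monomial_zero_right {n : ℕ} (p : Fin n → ℕ) :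
    monomial p (0 : Fin n → ℂ) = if p = 0 then 1 else 0 := by
  split_ifs with h
  · simp [monomial, h]
  · obtain ⟨i, hi⟩ := Function.ne_iff.1 h
    exact Finset.prod_eq_zero (Finset.mem_univ i) (by simpa using hi)

/-- A point of the ball is dominated, strictly in every coordinate, by another one. -/
lemma exists_dominating {n : ℕ} {z : Fin n → ℂ} (hz : z ∈ unitBall n) :
    ∃ w : Fin n → ℝ, (∀ i, ‖z i‖ < w i) ∧ (fun i => (w i : ℂ)) ∈ unitBall n := by
  have hc : Continuous fun ε : ℝ => ∑ i, (‖z i‖ + ε) ^ 2 := by fun_prop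
  have h0 : ∀ᶠ ε in nhdsWithin (0 : ℝ) (Ioi 0), ∑ i, (‖z i‖ + ε) ^ 2 < 1 := by
    refine (hc.tendsto 0).mono_left nhdsWithin_le_nhds |>.eventually (gt_mem_nhds ?_)
    simpa using mem_unitBall.1 hz
  obtain ⟨ε, hε, hpos⟩ := (h0.and self_mem_nhdsWithin).exists
  have hpos : 0 < ε := hpos
  refine ⟨fun i => ‖z i‖ + ε, fun i => by linarith, ?_⟩
  rw [mem_unitBall]
  refine lt_of_eq_of_lt (Finset.sum_congr rfl fun i _ => ?_) hε
  rw [Complex.norm_real, Real.norm_eq_abs, sq_abs]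

lemma HasExpansion.congr {n : ℕ} {F G : (Fin n → ℂ) → ℂ} {a : (Fin n → ℕ) → ℂ}
    (h : HasExpansion F a) (hFG : EqOn F G (unitBall n)) : HasExpansion G a :=
  fun z hz => hFG hz ▸ h z hz

lemma HasExpansion.sub {n : ℕ} {F G : (Fin n → ℂ) → ℂ} {a b : (Fin n → ℕ) → ℂ}
    (hF : HasExpansion F a) (hG : HasExpansion G b) :
    HasExpansion (fun z => F z - G z) (fun p => a p - b p) := fun z hz => by
  simpa only [sub_mul] using (hF z hz).sub (hG z hz)

lemma monomial_add_single {n : ℕ} (p : Fin n → ℕ) (i : Fin n) (z : Fin n → ℂ) (t : ℂ) :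
    monomial p (z + t • Pi.single i 1) =
      (z i + t) ^ p i * ∏ j ∈ Finset.univ.erase i, z j ^ p j := by
  rw [monomial, ← Finset.mul_prod_erase _ _ (Finset.mem_univ i)]
  congr 1
  · simp
  · refine Finset.prod_congr rfl fun j hj => ?_
    simp [Pi.single_eq_of_ne (Finset.ne_of_mem_erase hj)]

lemma monomial_eq_erase {n : ℕ} (p : Fin n → ℕ) (i : Fin n) (z : Fin n → ℂ) :
    monomial p z = z i ^ p i * ∏ j ∈ Finset.univ.erase i, z j ^ p j :=
  (Finset.mul_prod_erase _ _ (Finset.mem_univ i)).symm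

/-- Termwise differentiation on a complex line in direction `i`: the terms are dominated by those at
a point `w` of the ball with larger coordinates, where the series converges absolutely, so
Weierstrass' theorem applies. -/
lemma HasExpansion.pderiv {n : ℕ} {F : (Fin n → ℂ) → ℂ} {a : (Fin n → ℕ) → ℂ}
    (h : HasExpansion F a) (i : Fin n) :
    HasExpansion (pderiv i F) (fun p => ((p i + 1 : ℕ) : ℂ) * a (p + Pi.single i 1)) := by
  intro z hz
  obtain ⟨w, hw, hwb⟩ := exists_dominating hz
  have hw0 : ∀ j, ‖(w j : ℂ)‖ = w j := fun j => by
    rw [Complex.norm_real, Real.norm_of_nonneg ((norm_nonneg _).trans (hw j).le)]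
  -- This disc is centred at `-z i`; it is exactly where the line through `z` stays in the polydisc
  -- of `w`.
  set U : Set ℂ := {t | ‖z i + t‖ < w i}
  have hU : IsOpen U := isOpen_lt (by fun_prop) continuous_const
  have h0 : (0 : ℂ) ∈ U := by simpa [U] using hw i
  have hle : ∀ t ∈ U, ∀ j, ‖(z + t • Pi.single i (1 : ℂ) : Fin n → ℂ) j‖ ≤ ‖(w j : ℂ)‖ := by
    intro t ht j
    rw [hw0]
    by_cases hj : j = i
    · subst hj; simpa using le_of_lt ht
    · simpa [Pi.single_eq_of_ne hj] using (hw j).le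
  have key := Complex.hasSum_deriv_of_summable_norm (U := U)
    (F := fun p t => a p * monomial p (z + t • Pi.single i 1)) (h _ hwb).summable.norm
    (fun p => by
      simp only [monomial_add_single]
      fun_prop) hU
    (fun p t ht => by
      rw [norm_mul, norm_mul]
      gcongr
      exact norm_monomial_le p (hle t ht)) h0
  have hsum : deriv (fun t : ℂ => ∑' p, a p * monomial p (z + t • Pi.single i 1)) 0 =
      BergmanDirichlet.pderiv i F z := by
    rw [BergmanDirichlet.pderiv, lineDeriv]
    have : (fun t : ℂ => ∑' p, a p * monomial p (z + t • Pi.single i 1)) =ᶠ[nhds 0]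
        fun t => F (z + t • Pi.single i 1) := by
      filter_upwards [hU.mem_nhds h0] with t ht
      exact (h _ (mem_unitBall_of_le hwb (hle t ht))).tsum_eq
    exact this.deriv_eq
  rw [hsum] at key
  have hderiv : ∀ p : Fin n → ℕ, deriv (fun t : ℂ => a p * monomial p (z + t • Pi.single i 1)) 0 =
      a p * (p i * z i ^ (p i - 1) * ∏ j ∈ Finset.univ.erase i, z j ^ p j) := by
    intro p
    simp only [monomial_add_single]
    have h1 : HasDerivAt (fun t : ℂ => (z i + t) ^ p i) (p i * z i ^ (p i - 1)) 0 := by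
      simpa using! ((hasDerivAt_id (0 : ℂ)).const_add (z i)).pow (p i)
    exact ((h1.mul_const _).const_mul (a p)).deriv
  simp only [hderiv] at key
  have hinj : Function.Injective fun p : Fin n → ℕ => p + Pi.single i 1 :=
    fun p q hpq => add_right_cancel hpq
  -- The terms with `p i = 0` have derivative zero, and all other indices have the form `p + eᵢ`.
  rw [← hinj.hasSum_iff] at key
  · refine hasSum_of_forall_eq key fun p => ?_
    simp only [Function.comp_apply, Pi.add_apply, Pi.single_eq_same, Nat.add_sub_cancel,
      monomial_eq_erase p i]
    have : ∏ j ∈ Finset.univ.erase i, z j ^ (p j + (Pi.single i 1 : Fin n → ℕ) j) =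
        ∏ j ∈ Finset.univ.erase i, z j ^ p j :=
      Finset.prod_congr rfl fun j hj => by simp [Pi.single_eq_of_ne (Finset.ne_of_mem_erase hj)]
    rw [this]
    ring
  · intro p hp
    have : p i = 0 := by
      by_contra hpi
      refine hp ⟨p - Pi.single i 1, funext fun j => ?_⟩
      by_cases hj : j = i
      · subst hj; simp; omega
      · simp [Pi.single_eq_of_ne hj]
    simp [this]

lemma HasExpansion.pderiv_iterate {n : ℕ} {F : (Fin n → ℂ) → ℂ} {a : (Fin n → ℕ) → ℂ}
    (h : HasExpansion F a) (i : Fin n) (k : ℕ) :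
    HasExpansion ((BergmanDirichlet.pderiv i)^[k] F)
      (fun p => ((p i + k).descFactorial k : ℂ) * a (p + Pi.single i k)) := by
  induction k with
  | zero => simpa using h
  | succ k ih =>
    rw [Function.iterate_succ_apply']
    convert ih.pderiv i using 2 with p
    simp only [Pi.add_apply, Pi.single_eq_same]
    rw [add_assoc p, ← Pi.single_add, add_comm 1 k, ← mul_assoc, ← Nat.cast_mul]
    congr 2
    rw [show p i + (k + 1) = (p i + k) + 1 by ring, show p i + 1 + k = (p i + k) + 1 by ring,
      Nat.descFactorial_succ, show p i + k + 1 - k = p i + 1 by omega]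

lemma HasExpansion.partialD {n : ℕ} {F : (Fin n → ℂ) → ℂ} {a : (Fin n → ℕ) → ℂ}
    (h : HasExpansion F a) (q : Fin n → ℕ) :
    HasExpansion (partialD q F)
      (fun p => ((∏ i, (p i + q i).descFactorial (q i) : ℕ) : ℂ) * a (p + q)) := by
  -- Without repetitions in the list, each coordinate is shifted by `q i` exactly once.
  have key : ∀ l : List (Fin n), l.Nodup →
      HasExpansion (l.foldr (fun i G => (BergmanDirichlet.pderiv i)^[q i] G) F)
        (fun p => ((l.map fun i => (p i + q i).descFactorial (q i)).prod : ℕ) *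
          a (p + fun i => if i ∈ l then q i else 0)) := by
    intro l
    induction l with
    | nil => intro _; simpa using! h
    | cons i l ih =>
      intro hl
      obtain ⟨hi, hl⟩ := List.nodup_cons.1 hl
      rw [List.foldr_cons]
      convert (ih hl).pderiv_iterate i (q i) using 2 with p
      simp only [List.map_cons, List.prod_cons]
      rw [Nat.cast_mul, mul_assoc]
      congr 2
      · congr 2
        refine List.map_congr_left fun j hj => ?_
        have : j ≠ i := fun h => hi (h ▸ hj)
        simp [Pi.single_eq_of_ne this]
      · rw [add_assoc]
        congr 2
        funext j
        by_cases hj : j = i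
        · subst hj; simp [hi]
        · simp [hj]
  have := key (List.finRange n) (List.nodup_finRange n)
  simp only [List.mem_finRange, if_true, ← List.ofFn_eq_map, List.prod_ofFn] at this
  exact this

/-- At the origin only the constant term of the expansion of `D^p F` survives. This is also the
uniqueness of expansions. -/
lemma HasExpansion.taylorCoeff_eq {n : ℕ} {F : (Fin n → ℂ) → ℂ} {a : (Fin n → ℕ) → ℂ}
    (h : HasExpansion F a) (p : Fin n → ℕ) : taylorCoeff F p = a p := by
  have h1 := (h.partialD p) 0 (zero_mem_unitBall n)
  have h2 := h1.unique (hasSum_single 0 fun q hq => by simp [monomial_zero_right, hq])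
  rw [taylorCoeff, h2]
  simp only [monomial_zero_right, if_true, mul_one, Pi.zero_apply, zero_add,
    Nat.descFactorial_self, multiFactorial]
  have : ((∏ i, (p i)! : ℕ) : ℂ) ≠ 0 :=
    Nat.cast_ne_zero.2 (Finset.prod_ne_zero_iff.2 fun i _ => Nat.factorial_ne_zero _)
  field_simp

/-! ### Grouping by degree, and analyticity of multiple power series. -/

lemma mem_multiIndices {n k : ℕ} {p : Fin n → ℕ} : p ∈ multiIndices n k ↔ ∑ i, p i = k := by
  simp [multiIndices]

/-- Summation of a multiple series by degrees. -/
lemma hasSum_sum_multiIndices {n : ℕ} {f : (Fin n → ℕ) → ℂ} {s : ℂ} (h : HasSum f s) :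
    HasSum (fun k => ∑ p ∈ multiIndices n k, f p) s := by
  have := h.tsum_fiberwise (fun p => ∑ i, p i)
  refine hasSum_of_forall_eq this fun k => ?_
  have hs : ((fun p : Fin n → ℕ => ∑ i, p i) ⁻¹' {k}) = (multiIndices n k : Set (Fin n → ℕ)) := by
    ext p; simp [mem_multiIndices]
  rw [hs]
  exact (Finset.tsum_subtype (multiIndices n k) f).symm

/-- The monomial `z^p` as a multilinear form evaluated on the diagonal. -/
lemma exists_multilinear_monomial {n k : ℕ} (p : Fin n → ℕ) (hp : p ∈ multiIndices n k) :
    ∃ M : ContinuousMultilinearMap ℂ (fun _ : Fin k => Fin n → ℂ) ℂ,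
      ‖M‖ ≤ 1 ∧ ∀ z, M (fun _ => z) = monomial p z := by
  obtain rfl := mem_multiIndices.1 hp
  -- The `|p|` arguments are split into blocks of lengths `p i`, and block `i` reads off the
  -- coordinate `i`.
  refine ⟨(ContinuousMultilinearMap.mkPiAlgebra ℂ (Fin (∑ i, p i)) ℂ).compContinuousLinearMap
    (fun j => ContinuousLinearMap.proj (finSigmaFinEquiv.symm j).1), ?_, fun z => ?_⟩
  · refine ContinuousMultilinearMap.opNorm_le_bound zero_le_one fun v => ?_
    simp only [ContinuousMultilinearMap.compContinuousLinearMap_apply,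
      ContinuousMultilinearMap.mkPiAlgebra_apply, ContinuousLinearMap.proj_apply, one_mul,
      norm_prod]
    gcongr with j
    exact norm_le_pi_norm (v j) _
  · simp only [ContinuousMultilinearMap.compContinuousLinearMap_apply,
      ContinuousMultilinearMap.mkPiAlgebra_apply, ContinuousLinearMap.proj_apply]
    rw [← finSigmaFinEquiv.prod_comp, Fintype.prod_sigma]
    simp [monomial]

/-- In the sup norm of `Fin n → ℂ` the unit polydisc is the unit ball. The terms of degree `k` form
a multilinear map of norm at most `∑ ‖b p‖`, so the radius of convergence is at least 1. -/
lemma analyticAt_of_hasSum_polydisc {n : ℕ} {G : (Fin n → ℂ) → ℂ} {b : (Fin n → ℕ) → ℂ}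
    (hb : Summable fun p => ‖b p‖)
    (h : ∀ u : Fin n → ℂ, ‖u‖ < 1 → HasSum (fun p => b p * monomial p u) (G u))
    {u : Fin n → ℂ} (hu : ‖u‖ < 1) : AnalyticAt ℂ G u := by
  choose! M hM1 hM2 using fun (k : ℕ) (p : Fin n → ℕ) (hp : p ∈ multiIndices n k) =>
    exists_multilinear_monomial p hp
  let Q : FormalMultilinearSeries ℂ (Fin n → ℂ) ℂ := fun k => ∑ p ∈ multiIndices n k, b p • M k p
  have hQ : HasFPowerSeriesOnBall G Q 0 1 := by
    refine ⟨?_, one_pos, fun {y} hy => ?_⟩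
    · refine Q.le_radius_of_bound (r := 1) (∑' p, ‖b p‖) fun k => ?_
      simp only [NNReal.coe_one, one_pow, mul_one]
      refine (norm_sum_le _ _).trans (le_trans (Finset.sum_le_sum fun p hp => ?_)
        (hb.sum_le_tsum (multiIndices n k) fun _ _ => norm_nonneg _))
      rw [norm_smul]
      exact mul_le_of_le_one_right (norm_nonneg _) (hM1 k p hp)
    · have hy : ‖y‖ < 1 := by simpa [← ofReal_norm] using hy
      rw [zero_add]
      refine hasSum_of_forall_eq (hasSum_sum_multiIndices (h y hy)) fun k => ?_
      simp only [Q, sum_apply, smul_apply,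
        smul_eq_mul]
      exact Finset.sum_congr rfl fun p hp => by rw [hM2 k p hp]
  exact hQ.analyticOnNhd u (by simpa [← ofReal_norm] using hu)

/-- Rescaling the coordinates by a dominating point of the ball reduces the claim to the unit
polydisc. -/
lemma HasExpansion.analyticOnNhd {n : ℕ} {F : (Fin n → ℂ) → ℂ} {a : (Fin n → ℕ) → ℂ}
    (h : HasExpansion F a) : AnalyticOnNhd ℂ F (unitBall n) := by
  intro z hz
  obtain ⟨w, hw, hwb⟩ := exists_dominating hz
  have hwpos : ∀ i, 0 < w i := fun i => (norm_nonneg _).trans_lt (hw i)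
  have hwne : ∀ i, (w i : ℂ) ≠ 0 := fun i => by exact_mod_cast (hwpos i).ne'
  set W : Fin n → ℂ := fun i => w i
  have hG : AnalyticAt ℂ (fun u : Fin n → ℂ => F (W * u)) (fun i => z i / w i) := by
    refine analyticAt_of_hasSum_polydisc (b := fun p => a p * monomial p W)
      (h W hwb).summable.norm (fun u hu => ?_) ?_
    · simp only [mul_assoc, ← monomial_mul]
      refine h _ (mem_unitBall_of_le hwb fun i => ?_)
      rw [Pi.mul_apply, norm_mul]
      exact mul_le_of_le_one_right (norm_nonneg _) ((norm_le_pi_norm u i).trans hu.le)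
    · refine (pi_norm_lt_iff one_pos).2 fun i => ?_
      rw [norm_div, Complex.norm_real, Real.norm_of_nonneg (hwpos i).le, div_lt_one (hwpos i)]
      exact hw i
  have hlin : AnalyticAt ℂ (fun z : Fin n → ℂ => fun i => z i / (w i : ℂ)) z := by
    refine AnalyticAt.pi fun i => ?_
    have h1 : AnalyticAt ℂ (fun z : Fin n → ℂ => z i) z :=
      ContinuousLinearMap.analyticAt (ContinuousLinearMap.proj i : (Fin n → ℂ) →L[ℂ] ℂ) z
    exact h1.div analyticAt_const (hwne i)
  refine (AnalyticAt.fun_comp (g := fun u : Fin n → ℂ => F (W * u)) hG hlin).congr ?_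
  refine Filter.Eventually.of_forall fun z => ?_
  have : (W * fun i => z i / (w i : ℂ)) = z := funext fun i => by
    simp [W, mul_div_cancel₀ _ (hwne i)]
  simp [this]

/-! ### The weighted integral of `|z^p|²` over the ball. -/

lemma lintegral_comp_sq_mul (g : ℝ → ℝ≥0∞) :
    ∫⁻ r in Ioi (0 : ℝ), ENNReal.ofReal (2 * r) * g (r ^ 2) = ∫⁻ t in Ioi (0 : ℝ), g t := by
  have himg : (fun r : ℝ => r ^ 2) '' Ioi 0 = Ioi 0 := by
    ext t
    constructor
    · rintro ⟨r, hr, rfl⟩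
      exact pow_pos (mem_Ioi.1 hr) 2
    · intro ht
      exact ⟨√t, Real.sqrt_pos.2 ht, Real.sq_sqrt (le_of_lt ht)⟩
  have h := lintegral_image_eq_lintegral_abs_deriv_mul (s := Ioi (0 : ℝ)) (f := fun r => r ^ 2)
    (f' := fun r => 2 * r) measurableSet_Ioi
    (fun r _ => by simpa using (hasDerivAt_pow 2 r).hasDerivWithinAt)
    (fun a ha b hb hab => by
      exact (pow_left_inj₀ (le_of_lt (mem_Ioi.1 ha)) (le_of_lt (mem_Ioi.1 hb)) two_ne_zero).1 hab)
    g
  rw [himg] at h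
  rw [h]
  refine setLIntegral_congr_fun measurableSet_Ioi fun r hr => ?_
  rw [abs_of_pos (by have := mem_Ioi.1 hr; positivity)]

/-- Integration of radial functions on the complex plane. -/
lemma lintegral_radial {g : ℝ → ℝ≥0∞} (hg : Measurable g) :
    ∫⁻ z : ℂ, g (‖z‖ ^ 2) = ENNReal.ofReal Real.pi * ∫⁻ t in Ioi (0 : ℝ), g t := by
  rw [← Complex.lintegral_comp_polarCoord_symm]
  simp only [Complex.norm_polarCoord_symm, sq_abs, smul_eq_mul]
  rw [polarCoord_target, Measure.volume_eq_prod, ← Measure.prod_restrict,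
    lintegral_prod _ (by fun_prop)]
  simp only [lintegral_const, Measure.restrict_apply MeasurableSet.univ, univ_inter,
    Real.volume_Ioo]
  rw [lintegral_mul_const _ (by fun_prop), ← lintegral_comp_sq_mul g]
  have h2 : ∀ r : ℝ, ENNReal.ofReal (2 * r) * g (r ^ 2) =
      ENNReal.ofReal 2 * (ENNReal.ofReal r * g (r ^ 2)) := fun r => by
    rw [ENNReal.ofReal_mul zero_le_two, mul_assoc]
  simp only [h2]
  rw [lintegral_const_mul _ (by fun_prop), ← mul_assoc, ← ENNReal.ofReal_mul Real.pi_pos.le,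
    mul_comm, show Real.pi - -Real.pi = Real.pi * 2 by ring]

/-- Read off from the fact that the density of the Beta distribution has total mass 1. -/
lemma lintegral_beta {a b : ℝ} (ha : 0 < a) (hb : 0 < b) :
    ∫⁻ x in Ioo (0 : ℝ) 1, ENNReal.ofReal (x ^ (a - 1) * (1 - x) ^ (b - 1)) =
      ENNReal.ofReal (ProbabilityTheory.beta a b) := by
  have hB := ProbabilityTheory.beta_pos ha hb
  have h := ProbabilityTheory.lintegral_betaPDF_eq_one ha hb
  rw [ProbabilityTheory.lintegral_betaPDF] at h
  simp only [mul_assoc, ENNReal.ofReal_mul (one_div_pos.2 hB).le] at h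
  rw [lintegral_const_mul' _ _ ENNReal.ofReal_ne_top] at h
  calc _ = ENNReal.ofReal (ProbabilityTheory.beta a b) *
        (ENNReal.ofReal (1 / ProbabilityTheory.beta a b) *
          ∫⁻ x in Ioo (0 : ℝ) 1, ENNReal.ofReal (x ^ (a - 1) * (1 - x) ^ (b - 1))) := by
        rw [← mul_assoc, ← ENNReal.ofReal_mul hB.le, mul_one_div_cancel hB.ne', ENNReal.ofReal_one,
          one_mul]
    _ = _ := by rw [h, mul_one]

lemma lintegral_pow_mul_rpow (k : ℕ) {β R : ℝ} (hβ : -1 < β) (hR : 0 < R) :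
    ∫⁻ t in Ioo (0 : ℝ) R, ENNReal.ofReal (t ^ k * (R - t) ^ β) =
      ENNReal.ofReal (k ! * Real.Gamma (β + 1) / Real.Gamma (k + β + 2) * R ^ (k + β + 1)) := by
  have himg : (fun s : ℝ => R * s) '' Ioo 0 1 = Ioo 0 R := by
    simp [Set.image_mul_left_Ioo hR]
  have h := lintegral_image_eq_lintegral_abs_deriv_mul (s := Ioo (0 : ℝ) 1) (f := fun s => R * s)
    (f' := fun _ => R) measurableSet_Ioo
    (fun r _ => by simpa using ((hasDerivAt_id r).const_mul R).hasDerivWithinAt)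
    (fun a _ b _ hab => mul_left_cancel₀ hR.ne' hab)
    (fun t => ENNReal.ofReal (t ^ k * (R - t) ^ β))
  rw [himg] at h
  have h2 : ∫⁻ s in Ioo (0 : ℝ) 1, ENNReal.ofReal |R| *
      ENNReal.ofReal ((R * s) ^ k * (R - R * s) ^ β) =
      ∫⁻ s in Ioo (0 : ℝ) 1, ENNReal.ofReal (R ^ (k + β + 1)) *
        ENNReal.ofReal (s ^ ((k + 1 : ℝ) - 1) * (1 - s) ^ ((β + 1) - 1)) := by
    refine setLIntegral_congr_fun measurableSet_Ioo fun s hs => ?_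
    obtain ⟨hs0, hs1⟩ := hs
    rw [← ENNReal.ofReal_mul (abs_nonneg R), ← ENNReal.ofReal_mul (by positivity), abs_of_pos hR,
      add_sub_cancel_right, add_sub_cancel_right, Real.rpow_natCast, Real.rpow_add hR,
      Real.rpow_add hR, Real.rpow_natCast, Real.rpow_one, show R - R * s = R * (1 - s) by ring,
      Real.mul_rpow hR.le (by linarith)]
    congr 1
    ring
  rw [h, h2, lintegral_const_mul' _ _ ENNReal.ofReal_ne_top,
    lintegral_beta (by positivity) (by linarith), ← ENNReal.ofReal_mul (by positivity),
    ProbabilityTheory.beta, Real.Gamma_nat_eq_factorial, mul_comm,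
    show (k : ℝ) + 1 + (β + 1) = k + β + 2 by ring]

/-- The density `|z^p|² (R - |z|²)^β` on the ball of squared radius `R`. -/
def ballIntegrand {n : ℕ} (p : Fin n → ℕ) (β R : ℝ) (z : Fin n → ℂ) : ℝ≥0∞ :=
  if ∑ i, ‖z i‖ ^ 2 < R then
    ENNReal.ofReal ((∏ i, (‖z i‖ ^ 2) ^ p i) * (R - ∑ i, ‖z i‖ ^ 2) ^ β) else 0

lemma measurable_ballIntegrand {n : ℕ} (p : Fin n → ℕ) (β R : ℝ) :
    Measurable (ballIntegrand p β R) :=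
  Measurable.ite (measurableSet_lt (by fun_prop) measurable_const) (by fun_prop) measurable_const

lemma lintegral_disc (k : ℕ) {β R : ℝ} (hβ : -1 < β) (hR : 0 < R) :
    ∫⁻ z : ℂ, (if ‖z‖ ^ 2 < R then
      ENNReal.ofReal ((‖z‖ ^ 2) ^ k * (R - ‖z‖ ^ 2) ^ β) else 0) =
      ENNReal.ofReal (Real.pi * (k ! * Real.Gamma (β + 1) / Real.Gamma (k + β + 2) *
        R ^ (k + β + 1))) := by
  have hm : Measurable fun t : ℝ =>
      if t < R then ENNReal.ofReal (t ^ k * (R - t) ^ β) else 0 :=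
    Measurable.ite measurableSet_Iio (by fun_prop) measurable_const
  rw [lintegral_radial hm, ENNReal.ofReal_mul Real.pi_pos.le, ← lintegral_pow_mul_rpow k hβ hR]
  congr 1
  rw [← lintegral_indicator measurableSet_Ioi, ← lintegral_indicator measurableSet_Ioo]
  refine lintegral_congr fun t => ?_
  simp only [indicator, mem_Ioi, mem_Ioo]
  split_ifs <;> first | rfl | (exfalso; tauto)

/-- Induction on the dimension by splitting off the first coordinate `x`. The slice is a ball of
squared radius `R - |x|²`, hence the general `R`; its integral is a constant times `|x|^(2 p₀) (R -
|x|²)^γ`, and what remains is an integral over a disc with `γ` in place of `β`. -/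
lemma lintegral_ballIntegrand {n : ℕ} (p : Fin n → ℕ) {β R : ℝ} (hβ : -1 < β) (hR : 0 < R) :
    ∫⁻ z, ballIntegrand p β R z = ENNReal.ofReal (Real.pi ^ n * (∏ i, ((p i)! : ℝ)) *
      Real.Gamma (β + 1) / Real.Gamma (n + ∑ i, (p i : ℝ) + β + 1) *
        R ^ (n + ∑ i, (p i : ℝ) + β)) := by
  induction n generalizing R with
  | zero =>
    have : Real.Gamma (β + 1) ≠ 0 := (Real.Gamma_pos_of_pos (by linarith)).ne'
    rw [Measure.volume_pi_eq_dirac 0, lintegral_dirac]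
    simp [ballIntegrand, hR, this]
  | succ n ih =>
    set e := MeasurableEquiv.piFinSuccAbove (fun _ : Fin (n + 1) => ℂ) 0
    have he : MeasurePreserving e.symm volume volume :=
      (volume_preserving_piFinSuccAbove (fun _ : Fin (n + 1) => ℂ) 0).symm
    rw [← he.lintegral_comp (measurable_ballIntegrand p β R), Measure.volume_eq_prod,
      lintegral_prod (fun x => ballIntegrand p β R (e.symm x))
        ((measurable_ballIntegrand p β R).comp e.symm.measurable).aemeasurable]
    set q : Fin n → ℕ := fun i => p i.succ
    set C : ℝ := Real.pi ^ n * (∏ i, ((q i)! : ℝ)) *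
      Real.Gamma (β + 1) / Real.Gamma (n + ∑ i, (q i : ℝ) + β + 1)
    set γ : ℝ := n + ∑ i, (q i : ℝ) + β
    have hγ : -1 < γ := by
      have : (0 : ℝ) ≤ n + ∑ i, (q i : ℝ) := by positivity
      linarith
    have hC : 0 ≤ C := by
      have := Real.Gamma_pos_of_pos (show 0 < β + 1 by linarith)
      have := Real.Gamma_pos_of_pos (show 0 < n + ∑ i, (q i : ℝ) + β + 1 by linarith)
      positivity
    have hcons : ∀ (x : ℂ) (y : Fin n → ℂ), e.symm (x, y) = Fin.cons x y := fun x y => by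
      simp [e, MeasurableEquiv.piFinSuccAbove, Fin.insertNthEquiv]
    have hinner : ∀ x : ℂ, ∫⁻ y, ballIntegrand p β R (e.symm (x, y)) =
        ENNReal.ofReal C * (if ‖x‖ ^ 2 < R then
          ENNReal.ofReal ((‖x‖ ^ 2) ^ p 0 * (R - ‖x‖ ^ 2) ^ γ) else 0) := by
      intro x
      simp only [hcons]
      split_ifs with hx
      · have hx' : 0 < R - ‖x‖ ^ 2 := by linarith
        have : ∀ y : Fin n → ℂ, ballIntegrand p β R (Fin.cons x y) =
            ENNReal.ofReal ((‖x‖ ^ 2) ^ p 0) * ballIntegrand q β (R - ‖x‖ ^ 2) y := by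
          intro y
          simp only [ballIntegrand, Fin.sum_univ_succ, Fin.prod_univ_succ, Fin.cons_zero,
            Fin.cons_succ, lt_sub_iff_add_lt', mul_ite, mul_zero]
          congr 1
          rw [← ENNReal.ofReal_mul (by positivity), mul_assoc, sub_add_eq_sub_sub]
        simp only [this]
        rw [lintegral_const_mul' _ _ ENNReal.ofReal_ne_top, ih q hx',
          ← ENNReal.ofReal_mul (by positivity), ← ENNReal.ofReal_mul hC]
        congr 1
        ring
      · have : ∀ y : Fin n → ℂ, ballIntegrand p β R (Fin.cons x y) = 0 := by
          intro y
          simp only [ballIntegrand, Fin.sum_univ_succ, Fin.cons_zero, Fin.cons_succ]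
          rw [if_neg]
          have : 0 ≤ ∑ i, ‖y i‖ ^ 2 := by positivity
          linarith
        simp [this]
    simp only [hinner]
    rw [lintegral_const_mul' _ _ ENNReal.ofReal_ne_top, lintegral_disc (p 0) hγ hR,
      ← ENNReal.ofReal_mul hC]
    congr 1
    simp only [Fin.sum_univ_succ, Fin.prod_univ_succ, C]
    have h1 : (p 0 : ℝ) + γ + 1 = ((n + 1 : ℕ) : ℝ) + (p 0 + ∑ i : Fin n, (p i.succ : ℝ)) + β := by
      simp only [γ, q]; push_cast; ring
    have h2 : (p 0 : ℝ) + γ + 2 =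
        ((n + 1 : ℕ) : ℝ) + (p 0 + ∑ i : Fin n, (p i.succ : ℝ)) + β + 1 := by
      rw [← h1]; ring
    rw [h1, h2]
    have hg : Real.Gamma (γ + 1) ≠ 0 := (Real.Gamma_pos_of_pos (by linarith)).ne'
    -- The denominator `Γ(γ + 1)` of the slice cancels the numerator of the disc integral.
    change Real.pi ^ n * (∏ i, ((q i)! : ℝ)) * Real.Gamma (β + 1) / Real.Gamma (γ + 1) * _ = _
    field_simp
    ring

/-- The squared norm of `z^p`, `|p| = k`, in the weighted Bergman space is `p!` times this. -/
def bergmanConst (n : ℕ) (α : ℝ) (k : ℕ) : ℝ :=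
  Real.pi ^ n * Real.Gamma (α + 1) / Real.Gamma (α + n + 1 + k)

lemma bergmanConst_pos (n : ℕ) {α : ℝ} (hα : -1 < α) (k : ℕ) : 0 < bergmanConst n α k := by
  have h1 := Real.Gamma_pos_of_pos (show 0 < α + 1 by linarith)
  have h2 := Real.Gamma_pos_of_pos (show 0 < α + n + 1 + k by
    have : (0 : ℝ) ≤ n + k := by positivity
    linarith)
  unfold bergmanConst
  positivity

lemma measurable_weight (n : ℕ) (α : ℝ) :
    Measurable fun z : Fin n → ℂ => ENNReal.ofReal ((1 - ∑ i, ‖z i‖ ^ 2) ^ α) := by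
  fun_prop

lemma lintegral_weightedMeasure {n : ℕ} (α : ℝ) (G : (Fin n → ℂ) → ℝ≥0∞) :
    ∫⁻ z, G z ∂weightedMeasure n α = ∫⁻ z, (unitBall n).indicator
      (fun z => ENNReal.ofReal ((1 - ∑ i, ‖z i‖ ^ 2) ^ α) * G z) z := by
  rw [weightedMeasure, lintegral_withDensity_eq_lintegral_mul_non_measurable _
    (measurable_weight n α) (Filter.Eventually.of_forall fun _ => ENNReal.ofReal_lt_top),
    ← lintegral_indicator (isOpen_unitBall n).measurableSet]
  rfl

lemma lintegral_enorm_monomial_sq {n : ℕ} {α : ℝ} (hα : -1 < α) (p : Fin n → ℕ) :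
    ∫⁻ z, ‖monomial p z‖ₑ ^ 2 ∂weightedMeasure n α =
      ENNReal.ofReal (multiFactorial p * bergmanConst n α (∑ i, p i)) := by
  have h := lintegral_ballIntegrand p hα one_pos
  rw [lintegral_weightedMeasure]
  convert h using 1
  · refine lintegral_congr fun z => ?_
    classical
    rw [indicator_apply, ballIntegrand]
    simp only [mem_unitBall]
    split_ifs with hz
    · rw [← ofReal_norm, ← ENNReal.ofReal_pow (norm_nonneg _), norm_monomial,
        ← ENNReal.ofReal_mul (Real.rpow_nonneg (by linarith) _), mul_comm, ← Finset.prod_pow]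
      simp only [← pow_mul, mul_comm]
    · rfl
  · rw [Real.one_rpow, mul_one, bergmanConst, multiFactorial]
    congr 1
    push_cast
    rw [show α + n + 1 + ∑ i, (p i : ℝ) = n + ∑ i, (p i : ℝ) + α + 1 by ring]
    ring

/-! ### Parseval's identity by averaging over the torus. -/

/-- The circle `ℝ / ℤ` carries its Haar probability measure. -/
local instance : MeasureSpace UnitAddCircle := ⟨AddCircle.haarAddCircle⟩

local instance : Measure.IsAddHaarMeasure (volume : Measure UnitAddCircle) :=
  inferInstanceAs (Measure.IsAddHaarMeasure AddCircle.haarAddCircle)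

local instance : IsProbabilityMeasure (volume : Measure UnitAddCircle) :=
  inferInstanceAs (IsProbabilityMeasure AddCircle.haarAddCircle)

/-- The character of the torus that corresponds to the monomial `z^p`. -/
def torusChar {n : ℕ} (p : Fin n → ℕ) : C(UnitAddTorus (Fin n), ℂ) :=
  UnitAddTorus.mFourier fun i => (p i : ℤ)

lemma orthonormal_torusChar (n : ℕ) : Orthonormal ℂ fun p : Fin n → ℕ =>
    ContinuousMap.toLp (E := ℂ) 2 (volume : Measure (UnitAddTorus (Fin n))) ℂ (torusChar p) :=
  UnitAddTorus.orthonormal_mFourier.comp (fun (p : Fin n → ℕ) i => (p i : ℤ))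
    fun p q h => funext fun i => by simpa using congrFun h i

/-- Parseval's identity for absolutely convergent series on the torus. -/
lemma lintegral_torus_eq_tsum {n : ℕ} {c : (Fin n → ℕ) → ℂ} (hc : Summable fun p => ‖c p‖)
    {f : UnitAddTorus (Fin n) → ℂ} (hf : ∀ θ, HasSum (fun p => c p * torusChar p θ) (f θ)) :
    ∫⁻ θ, ‖f θ‖ₑ ^ 2 = ∑' p, ‖c p‖ₑ ^ 2 := by
  -- Characters have sup norm 1, so the series converges in the space of continuous functions and
  -- hence, through `toLp`, in `L²`.
  have hs : Summable fun p => c p • torusChar p := by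
    refine Summable.of_norm (hc.congr fun p => ?_)
    rw [norm_smul, torusChar, UnitAddTorus.mFourier_norm, mul_one]
  set g : C(UnitAddTorus (Fin n), ℂ) := ∑' p, c p • torusChar p
  have hg : ∀ θ, g θ = f θ := fun θ =>
    (ContinuousMap.hasSum_apply hs.hasSum θ).unique (hf θ)
  set L := ContinuousMap.toLp (E := ℂ) 2 (volume : Measure (UnitAddTorus (Fin n))) ℂ
  have hon := orthonormal_torusChar n
  have h1 : HasSum (fun p => c p • L (torusChar p)) (L g) := by
    simpa only [map_smul] using hs.hasSum.mapL L
  have h2 : ∀ q, inner ℂ (L (torusChar q)) (L g) = c q := by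
    intro q
    refine (h1.mapL (innerSL ℂ (L (torusChar q)))).unique ?_
    convert hasSum_single q fun p hp => ?_ using 1
    · simp only [innerSL_apply_apply, inner_smul_right]
      rw [inner_self_eq_norm_sq_to_K, hon.1 q]
      simp
    · simp only [innerSL_apply_apply, inner_smul_right]
      rw [hon.2 hp.symm, mul_zero]
  have h3 : HasSum (fun p => ((‖c p‖ ^ 2 : ℝ) : ℂ)) (inner ℂ (L g) (L g)) := by
    refine hasSum_of_forall_eq (h1.mapL (innerSL ℂ (L g))) fun p => ?_
    simp only [innerSL_apply_apply, inner_smul_right]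
    rw [← inner_conj_symm, h2, Complex.mul_conj, Complex.normSq_eq_norm_sq]
  have h4 : inner ℂ (L g) (L g) = ((∫ θ, ‖f θ‖ ^ 2 : ℝ) : ℂ) := by
    rw [ContinuousMap.inner_toLp, ← integral_complex_ofReal]
    refine integral_congr_ae (Filter.Eventually.of_forall fun θ => ?_)
    simp only [hg, Complex.mul_conj, Complex.normSq_eq_norm_sq]
  rw [h4] at h3
  have h5 : HasSum (fun p => ‖c p‖ ^ 2) (∫ θ, ‖f θ‖ ^ 2) := Complex.hasSum_ofReal.1 h3
  have hfc : Continuous f := (funext hg : ⇑g = f) ▸ g.continuous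
  have h6 := ofReal_integral_eq_lintegral_ofReal
    ((show Continuous fun θ => ‖f θ‖ ^ 2 by fun_prop).integrable_of_hasCompactSupport (μ := volume)
      (HasCompactSupport.of_compactSpace _))
    (Filter.Eventually.of_forall fun θ => sq_nonneg _)
  have e : ∀ x : ℂ, ENNReal.ofReal (‖x‖ ^ 2) = ‖x‖ₑ ^ 2 := fun x => by
    rw [ENNReal.ofReal_pow (norm_nonneg _), ofReal_norm]
  rw [← lintegral_congr fun θ => e (f θ), ← h6, ← h5.tsum_eq,
    ENNReal.ofReal_tsum_of_nonneg (fun p => by positivity) h5.summable]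
  simp only [e]

/-- The rotation of `ℂⁿ` by a point of the torus. -/
def rotate {n : ℕ} (θ : UnitAddTorus (Fin n)) (z : Fin n → ℂ) : Fin n → ℂ :=
  fun i => (AddCircle.toCircle (θ i) : ℂ) * z i

lemma norm_rotate {n : ℕ} (θ : UnitAddTorus (Fin n)) (z : Fin n → ℂ) (i : Fin n) :
    ‖rotate θ z i‖ = ‖z i‖ := by
  rw [rotate, norm_mul, Circle.norm_coe, one_mul]

lemma rotate_mem_unitBall {n : ℕ} (θ : UnitAddTorus (Fin n)) {z : Fin n → ℂ} :
    rotate θ z ∈ unitBall n ↔ z ∈ unitBall n := by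
  simp only [mem_unitBall, norm_rotate]

lemma continuous_rotate (n : ℕ) :
    Continuous fun x : UnitAddTorus (Fin n) × (Fin n → ℂ) => rotate x.1 x.2 := by
  unfold rotate
  refine continuous_pi fun i => ?_
  have h : Continuous (AddCircle.toCircle : AddCircle (1 : ℝ) → Circle) :=
    AddCircle.continuous_toCircle
  exact (continuous_subtype_val.comp (h.comp ((continuous_apply i).comp continuous_fst))).mul
    ((continuous_apply i).comp continuous_snd)

lemma monomial_rotate {n : ℕ} (p : Fin n → ℕ) (θ : UnitAddTorus (Fin n)) (z : Fin n → ℂ) :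
    monomial p (rotate θ z) = monomial p z * torusChar p θ := by
  simp only [monomial, rotate, torusChar, UnitAddTorus.mFourier, ContinuousMap.coe_mk, mul_pow,
    Finset.prod_mul_distrib]
  rw [mul_comm]
  congr 1
  refine Finset.prod_congr rfl fun i _ => ?_
  rw [fourier_apply, AddCircle.toCircle_zsmul]
  simp

lemma measurePreserving_rotate {n : ℕ} (θ : UnitAddTorus (Fin n)) :
    MeasurePreserving (rotate θ) (volume : Measure (Fin n → ℂ)) volume :=
  volume_preserving_pi fun i => (rotation (AddCircle.toCircle (θ i))).measurePreserving

lemma lintegral_rotate {n : ℕ} (α : ℝ) (θ : UnitAddTorus (Fin n)) {G : (Fin n → ℂ) → ℝ≥0∞}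
    (hG : Measurable G) :
    ∫⁻ z, G (rotate θ z) ∂weightedMeasure n α = ∫⁻ z, G z ∂weightedMeasure n α := by
  rw [lintegral_weightedMeasure, lintegral_weightedMeasure,
    ← (measurePreserving_rotate θ).lintegral_comp (f := (unitBall n).indicator
        fun z => ENNReal.ofReal ((1 - ∑ i, ‖z i‖ ^ 2) ^ α) * G z)
      (((measurable_weight n α).mul hG).indicator (isOpen_unitBall n).measurableSet)]
  classical
  refine lintegral_congr fun z => ?_
  simp only [indicator_apply, rotate_mem_unitBall, norm_rotate]

/-- Parseval's identity for holomorphic functions in the weighted Bergman space. -/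
lemma HasExpansion.bergmanNormSq_eq {n : ℕ} {α : ℝ} (hα : -1 < α) {F : (Fin n → ℂ) → ℂ}
    {a : (Fin n → ℕ) → ℂ} (h : HasExpansion F a) :
    bergmanNormSq α F =
      ∑' p, ‖a p‖ₑ ^ 2 * ENNReal.ofReal (multiFactorial p * bergmanConst n α (∑ i, p i)) := by
  classical
  -- `F` is arbitrary outside the ball; cutting it off there gives the measurability that Tonelli's
  -- theorem needs.
  set G : (Fin n → ℂ) → ℂ := (unitBall n).indicator F
  have hGF : ∀ z ∈ unitBall n, G z = F z := fun z hz => indicator_of_mem hz F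
  have hGm : Measurable G := by
    refine measurable_of_restrict_of_restrict_compl (isOpen_unitBall n).measurableSet ?_ ?_
    · have : (unitBall n).domRestrict G = (unitBall n).domRestrict F := by
        ext z; exact hGF z z.2
      rw [this]
      exact (continuousOn_iff_continuous_domRestrict.1 h.analyticOnNhd.continuousOn).measurable
    · have : (unitBall n)ᶜ.domRestrict G = fun _ => 0 := by
        ext z; exact indicator_of_notMem z.2 F
      rw [this]
      exact measurable_const
  have hG2 : Measurable fun z => ‖G z‖ₑ ^ 2 := hGm.enorm.pow_const 2
  have : SFinite (weightedMeasure n α) := by unfold weightedMeasure; infer_instance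
  calc bergmanNormSq α F = ∫⁻ z, ‖G z‖ₑ ^ 2 ∂weightedMeasure n α := by
        refine lintegral_congr_ae ?_
        filter_upwards [ae_mem_unitBall n α] with z hz
        rw [hGF z hz]
    -- Averaging over rotations changes nothing. After the interchange of integrals, the integrand
    -- in `θ` for fixed `z` is the squared modulus of an absolutely convergent Fourier series with
    -- coefficients `a p * z^p`.
    _ = ∫⁻ _ : UnitAddTorus (Fin n), ∫⁻ z, ‖G z‖ₑ ^ 2 ∂weightedMeasure n α := by
        rw [lintegral_const, measure_univ, mul_one]
    _ = ∫⁻ θ : UnitAddTorus (Fin n), ∫⁻ z, ‖G (rotate θ z)‖ₑ ^ 2 ∂weightedMeasure n α := by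
        simp only [lintegral_rotate α _ hG2]
    _ = ∫⁻ z, (∫⁻ θ : UnitAddTorus (Fin n), ‖G (rotate θ z)‖ₑ ^ 2) ∂weightedMeasure n α :=
        lintegral_lintegral_swap (f := fun θ z => ‖G (rotate θ z)‖ₑ ^ 2)
          (hG2.comp (continuous_rotate n).measurable).aemeasurable
    _ = ∫⁻ z, ∑' p, ‖a p‖ₑ ^ 2 * ‖monomial p z‖ₑ ^ 2 ∂weightedMeasure n α := by
        refine lintegral_congr_ae ?_
        filter_upwards [ae_mem_unitBall n α] with z hz
        rw [lintegral_torus_eq_tsum (c := fun p => a p * monomial p z) (h z hz).summable.norm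
          fun θ => ?_]
        · simp only [enorm_mul, mul_pow]
        · rw [hGF _ ((rotate_mem_unitBall θ).2 hz)]
          simpa only [monomial_rotate, mul_assoc] using h _ ((rotate_mem_unitBall θ).2 hz)
    _ = _ := by
        have hm : ∀ p : Fin n → ℕ, Continuous (monomial p) := fun p => by
          unfold monomial; fun_prop
        rw [lintegral_tsum fun p =>
          (((hm p).measurable.enorm.pow_const 2).const_mul _).aemeasurable]
        refine tsum_congr fun p => ?_
        rw [lintegral_const_mul _ ((hm p).measurable.enorm.pow_const 2),
          lintegral_enorm_monomial_sq hα]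

/-! ### Holomorphic functions on the ball are sums of power series -/

/-- The terms of a power series on the diagonal are polynomials. -/
lemma exists_diagonal_eq_sum_monomial {n k : ℕ}
    (P : ContinuousMultilinearMap ℂ (fun _ : Fin k => Fin n → ℂ) ℂ) :
    ∃ a : (Fin n → ℕ) → ℂ, ∀ z, P (fun _ => z) = ∑ p ∈ multiIndices n k, a p * monomial p z := by
  classical
  -- Expanding `P` over the basis gives one term for each choice `r` of a basis vector per argument;
  -- its monomial records how often each vector is chosen.
  let cnt : (Fin k → Fin n) → Fin n → ℕ := fun r i => (Finset.univ.filter fun j => r j = i).card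
  have hcnt : ∀ r, cnt r ∈ multiIndices n k := fun r => by
    rw [mem_multiIndices, ← Finset.card_eq_sum_card_fiberwise (s := Finset.univ) (t := Finset.univ)
      (fun _ _ => Finset.mem_coe.2 (Finset.mem_univ _))]
    simp
  refine ⟨fun p => ∑ r with cnt r = p, P fun j => Pi.single (r j) 1, fun z => ?_⟩
  have hz : (fun _ : Fin k => z) = fun _ => ∑ i, z i • (Pi.single i 1 : Fin n → ℂ) := by
    funext _
    refine (pi_eq_sum_univ' z).trans (Finset.sum_congr rfl fun i _ => ?_)
    congr 1
  have key : P (fun _ => z) =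
      ∑ r : Fin k → Fin n, monomial (cnt r) z * P fun j => Pi.single (r j) 1 := by
    rw [hz, P.map_sum]
    refine Finset.sum_congr rfl fun r _ => ?_
    rw [P.map_smul_univ, smul_eq_mul]
    congr 1
    rw [monomial, ← Finset.prod_fiberwise Finset.univ r]
    refine Finset.prod_congr rfl fun i _ => ?_
    rw [Finset.prod_congr rfl (g := fun _ => z i) fun j hj => by
      rw [(Finset.mem_filter.1 hj).2], Finset.prod_const]
  rw [key, ← Finset.sum_fiberwise_of_maps_to fun r _ => hcnt r]
  refine Finset.sum_congr rfl fun p _ => ?_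
  rw [Finset.sum_mul]
  refine Finset.sum_congr rfl fun r hr => ?_
  rw [(Finset.mem_filter.1 hr).2, mul_comm]

/-- Cauchy's estimates on the line through `0` and `z`. -/
lemma exists_slice_expansion {g : ℂ → ℂ} {R M : ℝ} (hR : 1 < R)
    (hg : DifferentiableOn ℂ g (Metric.ball 0 R)) {ρ : ℝ} (hρ : 1 < ρ) (hρR : ρ < R)
    (hM : ∀ ζ : ℂ, ‖ζ‖ = ρ → ‖g ζ‖ ≤ M) {c : ℕ → ℂ}
    (hc : ∃ s > 0, ∀ ζ : ℂ, ‖ζ‖ < s → HasSum (fun k => ζ ^ k * c k) (g ζ)) :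
    HasSum c (g 1) ∧ ∀ k, ‖c k‖ ≤ M * (ρ⁻¹) ^ k := by
  obtain ⟨s, hs, hcs⟩ := hc
  have hρ0 : 0 < ρ := by linarith
  -- The expansion is known only near 0. Uniqueness of one-variable power series identifies the `c
  -- k` with the Taylor coefficients, which are controlled on the large disc.
  have hco : ∀ k, c k = (k ! : ℂ)⁻¹ * iteratedDeriv k g 0 := by
    let Q : FormalMultilinearSeries ℂ ℂ ℂ := fun k =>
      ContinuousMultilinearMap.mkPiRing ℂ (Fin k) (c k)
    have h1 : HasFPowerSeriesAt g Q 0 := by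
      rw [hasFPowerSeriesAt_iff]
      filter_upwards [Metric.ball_mem_nhds (0 : ℂ) hs] with ζ hζ
      have := hcs ζ (by simpa using hζ)
      simpa [Q, FormalMultilinearSeries.coeff] using! this
    have h2 : HasFPowerSeriesAt g (FormalMultilinearSeries.ofScalars ℂ
        fun k => iteratedDeriv k g 0 / (k ! : ℂ)) 0 :=
      (hg.analyticAt (Metric.ball_mem_nhds 0 (by linarith))).hasFPowerSeriesAt
    intro k
    have := congrArg (fun Q : FormalMultilinearSeries ℂ ℂ ℂ => Q.coeff k)
      (h1.eq_formalMultilinearSeries h2)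
    simp only [FormalMultilinearSeries.coeff_ofScalars] at this
    rw [mul_comm, ← div_eq_mul_inv, ← this]
    simp [Q, FormalMultilinearSeries.coeff]
  constructor
  · have h := Complex.hasSum_taylorSeries_on_ball (c := 0) (r := R) (f := g) hg
      (z := 1) (by simpa using! hR)
    refine hasSum_of_forall_eq h fun k => ?_
    simp [hco]
  · intro k
    have hd : DiffContOnCl ℂ g (Metric.ball 0 ρ) :=
      (hg.mono (Metric.closedBall_subset_ball hρR)).diffContOnCl_ball Subset.rfl
    have := Complex.norm_iteratedDeriv_le_of_forall_mem_sphere_norm_le k hρ0 hd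
      (fun ζ hζ => hM ζ (by simpa using hζ))
    rw [hco, norm_mul, norm_inv, Complex.norm_natCast, inv_mul_le_iff₀ (by positivity)]
    refine this.trans (le_of_eq ?_)
    rw [inv_pow]
    ring

lemma summable_prod_pow {n : ℕ} {x : ℝ} (h0 : 0 ≤ x) (h1 : x < 1) :
    Summable fun p : Fin n → ℕ => x ^ ∑ i, p i := by
  induction n with
  | zero => exact Summable.of_finite
  | succ n ih =>
    have := (summable_geometric_of_lt_one h0 h1).mul_of_nonneg ih
      (fun k => by positivity) (fun p => by positivity)
    rw [← (Fin.consEquiv fun _ : Fin (n + 1) => ℕ).summable_iff]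
    refine this.congr fun y => ?_
    simp [Fin.consEquiv, Fin.sum_univ_succ, pow_add]

/-- A holomorphic function on the ball is the sum of its power series on the whole ball. -/
lemma exists_hasExpansion {n : ℕ} {F : (Fin n → ℂ) → ℂ}
    (hF : AnalyticOnNhd ℂ F (unitBall n)) : ∃ a, HasExpansion F a := by
  classical
  obtain ⟨P, r, hP⟩ := hF 0 (zero_mem_unitBall n)
  choose A hA using fun k => exists_diagonal_eq_sum_monomial (P k)
  set a : (Fin n → ℕ) → ℂ := fun p => A (∑ i, p i) p
  have hPa : ∀ k z, P k (fun _ => z) = ∑ p ∈ multiIndices n k, a p * monomial p z := by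
    intro k z
    rw [hA]
    refine Finset.sum_congr rfl fun p hp => ?_
    simp only [a, mem_multiIndices.1 hp]
  refine ⟨a, fun z hz => ?_⟩
  set t := ∑ i, ‖z i‖ ^ 2
  have ht : t < 1 := hz
  have ht0 : 0 ≤ t := by positivity
  -- Room beyond `z`: the slices are holomorphic on the disc of radius `R`, and Cauchy's estimates
  -- on a circle of radius `ρ` between 1 and `R` give geometric decay.
  obtain ⟨R, hR1, hRt⟩ : ∃ R : ℝ, 1 < R ∧ R ^ 2 * t < 1 := by
    have hc : Continuous fun R : ℝ => R ^ 2 * t := by fun_prop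
    have h0 : ∀ᶠ R in nhdsWithin (1 : ℝ) (Ioi 1), R ^ 2 * t < 1 :=
      (hc.tendsto 1).mono_left nhdsWithin_le_nhds |>.eventually (gt_mem_nhds (by simpa using ht))
    obtain ⟨R, h1, h2⟩ := (h0.and self_mem_nhdsWithin).exists
    exact ⟨R, h2, h1⟩
  obtain ⟨ρ, hρ1, hρR⟩ := exists_between hR1
  have hρt : ρ ^ 2 * t < 1 :=
    lt_of_le_of_lt (mul_le_mul_of_nonneg_right (pow_le_pow_left₀ (by linarith) hρR.le 2) ht0) hRt
  set K : Set (Fin n → ℂ) := {w | ∑ i, ‖w i‖ ^ 2 ≤ ρ ^ 2 * t}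
  have hKc : IsCompact K := by
    refine Metric.isCompact_of_isClosed_isBounded
      (isClosed_le (by fun_prop) continuous_const) ?_
    refine (Metric.isBounded_closedBall (x := (0 : Fin n → ℂ)) (r := 1)).subset fun w hw => ?_
    rw [mem_closedBall_zero_iff, pi_norm_le_iff_of_nonneg zero_le_one]
    intro i
    have h1 : ‖w i‖ ^ 2 ≤ ∑ i, ‖w i‖ ^ 2 :=
      Finset.single_le_sum (f := fun i => ‖w i‖ ^ 2) (fun i _ => by positivity)
        (Finset.mem_univ i)
    have h2 : ∑ i, ‖w i‖ ^ 2 ≤ ρ ^ 2 * t := hw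
    nlinarith [norm_nonneg (w i)]
  have hKb : K ⊆ unitBall n := fun w hw => lt_of_le_of_lt hw hρt
  obtain ⟨M, hM⟩ := hKc.exists_bound_of_continuousOn (hF.continuousOn.mono hKb)
  have hnorm : ∀ (ζ : ℂ) (w : Fin n → ℂ), ∑ i, ‖(ζ • w) i‖ ^ 2 = ‖ζ‖ ^ 2 * ∑ i, ‖w i‖ ^ 2 := by
    intro ζ w
    simp [mul_pow, Finset.mul_sum]
  -- All rotated points have the same Euclidean norm, so one bound `M` on the compact ball `K`
  -- serves every `θ`.
  have slice : ∀ θ : UnitAddTorus (Fin n),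
      HasSum (fun k => ∑ p ∈ multiIndices n k, a p * monomial p (rotate θ z)) (F (rotate θ z)) ∧
      ∀ k, ‖∑ p ∈ multiIndices n k, a p * monomial p (rotate θ z)‖ ≤ M * (ρ⁻¹) ^ k := by
    intro θ
    set w := rotate θ z
    have hwt : ∑ i, ‖w i‖ ^ 2 = t := by simp only [w, norm_rotate, t]
    have hd : DifferentiableOn ℂ (fun ζ : ℂ => F (ζ • w)) (Metric.ball 0 R) := by
      intro ζ hζ
      have hmem : ζ • w ∈ unitBall n := by
        rw [mem_unitBall, hnorm, hwt]
        have : ‖ζ‖ < R := by simpa using hζ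
        exact lt_of_le_of_lt (mul_le_mul_of_nonneg_right
          (pow_le_pow_left₀ (norm_nonneg _) this.le 2) ht0) hRt
      exact ((hF _ hmem).differentiableAt.comp ζ
        (differentiableAt_id.smul_const w)).differentiableWithinAt
    have := exists_slice_expansion (M := M)
      (c := fun k => ∑ p ∈ multiIndices n k, a p * monomial p w) hR1 hd hρ1 hρR
      (fun ζ hζ => hM _ (by
        change ∑ i, ‖(ζ • w) i‖ ^ 2 ≤ _
        rw [hnorm, hwt, hζ])) (by
      have hc : Continuous fun ζ : ℂ => ζ • w := by fun_prop
      have h0 : ∀ᶠ ζ : ℂ in nhds 0, ζ • w ∈ Metric.eball (0 : Fin n → ℂ) r :=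
        (hc.tendsto 0).eventually
          (by rw [zero_smul]; exact Metric.eball_mem_nhds (0 : Fin n → ℂ) hP.r_pos)
      obtain ⟨s, hs, hs'⟩ := Metric.eventually_nhds_iff.1 h0
      refine ⟨s, hs, fun ζ hζ => ?_⟩
      have h1 := hP.hasSum (hs' (by simpa using hζ))
      rw [zero_add] at h1
      refine hasSum_of_forall_eq h1 fun k => ?_
      have := (P k).map_smul_univ (fun _ => ζ) (fun _ => w)
      rw [this, hPa]
      simp)
    simpa using this
  -- Slices bound only whole homogeneous parts. Parseval on the torus isolates a single term: it is
  -- at most the `L²` norm of its homogeneous part, hence at most the sup norm.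
  have hbound : ∀ p, ‖a p * monomial p z‖ ≤ M * (ρ⁻¹) ^ ∑ i, p i := by
    intro p
    set k := ∑ i, p i with hk
    set c : (Fin n → ℕ) → ℂ := fun q => if q ∈ multiIndices n k then a q * monomial q z else 0
    have hcf : ∀ q ∉ multiIndices n k, c q = 0 := fun q hq => if_neg hq
    have h1 := lintegral_torus_eq_tsum (c := c)
      (summable_of_ne_finset_zero (s := multiIndices n k) fun q hq => by rw [hcf q hq, norm_zero])
      (f := fun θ => ∑ p ∈ multiIndices n k, a p * monomial p (rotate θ z)) fun θ => by
        have := hasSum_sum_of_ne_finset_zero (L := .unconditional _) (s := multiIndices n k)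
          (f := fun q => c q * torusChar q θ) (fun q hq => by rw [hcf q hq, zero_mul])
        convert this using 1
        refine Finset.sum_congr rfl fun q hq => ?_
        simp only [c, if_pos hq, monomial_rotate, mul_assoc]
    have hMk : 0 ≤ M * (ρ⁻¹) ^ k := (norm_nonneg _).trans ((slice 0).2 k)
    have h2 : ‖c p‖ₑ ^ 2 ≤ ENNReal.ofReal (M * (ρ⁻¹) ^ k) ^ 2 := by
      refine (ENNReal.le_tsum p).trans (h1.symm.le.trans ?_)
      refine (lintegral_mono (g := fun _ => ENNReal.ofReal (M * (ρ⁻¹) ^ k) ^ 2) fun θ => ?_).trans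
        (by rw [lintegral_const, measure_univ, mul_one])
      refine pow_le_pow_left' ?_ 2
      rw [← ofReal_norm]
      exact ENNReal.ofReal_le_ofReal ((slice θ).2 k)
    have h3 := (ENNReal.pow_right_strictMono two_ne_zero).le_iff_le.1 h2
    rw [← ofReal_norm, ENNReal.ofReal_le_ofReal_iff hMk] at h3
    simpa only [c, if_pos (mem_multiIndices.2 hk.symm)] using h3
  have hsum : Summable fun p => a p * monomial p z :=
    Summable.of_norm_bounded ((summable_prod_pow (by positivity)
      (inv_lt_one_of_one_lt₀ hρ1)).mul_left M) hbound
  have h0 : rotate (0 : UnitAddTorus (Fin n)) z = z := funext fun i => by simp [rotate]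
  have h1 := (slice 0).1
  rw [h0] at h1
  rw [h1.unique (hasSum_sum_multiIndices hsum.hasSum)]
  exact hsum.hasSum

/-! ### The norm of order `m` in terms of Taylor coefficients. -/

/-- The Vandermonde identity for several binomial coefficients. -/
lemma sum_multiIndices_prod_choose {n : ℕ} (m : ℕ) (r : Fin n → ℕ) :
    ∑ q ∈ multiIndices n m, ∏ i, (r i).choose (q i) = (∑ i, r i).choose m := by
  have h := PowerSeries.coeff_prod (fun i => (1 + PowerSeries.X : PowerSeries ℕ) ^ r i) m
    Finset.univ
  have hc : ∀ a k : ℕ, PowerSeries.coeff k ((1 + PowerSeries.X : PowerSeries ℕ) ^ a) =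
      a.choose k := fun a k => by
    have : (1 + PowerSeries.X : PowerSeries ℕ) ^ a =
        (((1 + Polynomial.X : Polynomial ℕ) ^ a : Polynomial ℕ) : PowerSeries ℕ) := by simp
    rw [this, Polynomial.coeff_coe, Polynomial.coeff_one_add_X_pow, Nat.cast_id]
  rw [Finset.prod_pow_eq_pow_sum, hc] at h
  rw [h]
  refine Finset.sum_equiv Finsupp.equivFunOnFinite.symm (fun q => ?_) fun q _ => ?_
  · simp [mem_multiIndices]
  · simp [hc]

lemma multiFactorial_pos {n : ℕ} (p : Fin n → ℕ) : 0 < multiFactorial p :=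
  Finset.prod_pos fun _ _ => Nat.factorial_pos _

lemma HasExpansion.taylorHead {n : ℕ} {F : (Fin n → ℂ) → ℂ} {a : (Fin n → ℕ) → ℂ}
    (h : HasExpansion F a) (m : ℕ) :
    HasExpansion (taylorHead m F) (fun p => if ∑ i, p i < m then a p else 0) := by
  classical
  intro z _
  have hd : (↑(Finset.range m) : Set ℕ).PairwiseDisjoint (multiIndices n) := by
    intro k _ l _ hkl
    refine Finset.disjoint_left.2 fun p hp hp' => hkl ?_
    rw [← mem_multiIndices.1 hp, ← mem_multiIndices.1 hp']
  have hmem : ∀ p : Fin n → ℕ,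
      p ∈ (Finset.range m).biUnion (multiIndices n) ↔ ∑ i, p i < m := fun p => by
    simp [mem_multiIndices]
  have := hasSum_sum_of_ne_finset_zero (L := .unconditional _)
    (s := (Finset.range m).biUnion (multiIndices n))
    (f := fun p => (if ∑ i, p i < m then a p else 0) * monomial p z)
    (fun p hp => by rw [if_neg (fun h => hp ((hmem p).2 h)), zero_mul])
  convert this using 1
  rw [Finset.sum_biUnion hd]
  refine Finset.sum_congr rfl fun k hk => Finset.sum_congr rfl fun p hp => ?_
  rw [mem_multiIndices.1 hp, if_pos (Finset.mem_range.1 hk), h.taylorCoeff_eq]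
  rfl

lemma HasExpansion.taylorTail {n : ℕ} {F : (Fin n → ℂ) → ℂ} {a : (Fin n → ℕ) → ℂ}
    (h : HasExpansion F a) (m : ℕ) :
    HasExpansion (taylorTail m F) (fun p => if ∑ i, p i < m then 0 else a p) := by
  have e : (fun p => if ∑ i, p i < m then 0 else a p) =
      fun p => a p - if ∑ i, p i < m then a p else 0 := by
    funext p
    split_ifs <;> simp
  rw [e]
  exact h.sub (h.taylorHead m)

/-- The squared norm of `z^p`, `|p| = k`, in the space of order `m` is `p!` times this. -/
def weight (n m : ℕ) (α : ℝ) (k : ℕ) : ℝ :=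
  if k < m then bergmanConst n α k else k.descFactorial m * bergmanConst n α (k - m)

lemma weight_pos (n m : ℕ) {α : ℝ} (hα : -1 < α) (k : ℕ) : 0 < weight n m α k := by
  unfold weight
  split_ifs with h
  · exact bergmanConst_pos n hα k
  · have : 0 < k.descFactorial m := Nat.descFactorial_pos.2 (not_lt.1 h)
    have := bergmanConst_pos n hα (k - m)
    positivity

/-- The arithmetic of `‖D^q z^r‖²`. If some `q i > r i`, both sides vanish, so the truncated `r - q`
does no harm. -/
lemma prod_descFactorial_sq_mul {n : ℕ} (r q : Fin n → ℕ) :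
    (∏ i, (r i).descFactorial (q i)) ^ 2 * multiFactorial (r - q) =
      multiFactorial q * (multiFactorial r * ∏ i, (r i).choose (q i)) := by
  simp only [multiFactorial, ← Finset.prod_pow, ← Finset.prod_mul_distrib]
  refine Finset.prod_congr rfl fun i _ => ?_
  by_cases h : q i ≤ r i
  · rw [Pi.sub_apply, sq, mul_assoc, mul_comm (Nat.descFactorial _ _) (r i - q i)!,
      Nat.factorial_mul_descFactorial h, Nat.descFactorial_eq_factorial_mul_choose]
    ring
  · rw [Nat.descFactorial_of_lt (not_le.1 h), Nat.choose_eq_zero_of_lt (not_le.1 h)]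
    simp

/-- Parseval for the derivative, reindexed by `r = p + q`. The binomials vanish unless `q ≤ r`, so
the sum may run over all `r`; its range no longer depends on `q`, which permits summing over `q`
inside. -/
lemma HasExpansion.bergmanNormSq_partialD {n m : ℕ} {α : ℝ} (hα : -1 < α)
    {F : (Fin n → ℂ) → ℂ} {a : (Fin n → ℕ) → ℂ} (h : HasExpansion F a) {q : Fin n → ℕ}
    (hq : q ∈ multiIndices n m) :
    (multiFactorial q : ℝ≥0∞)⁻¹ *
      bergmanNormSq α (BergmanDirichlet.partialD q (BergmanDirichlet.taylorTail m F)) =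
      ∑' r : Fin n → ℕ, ‖a r‖ₑ ^ 2 * ENNReal.ofReal (multiFactorial r *
        (∏ i, (r i).choose (q i) : ℕ) * bergmanConst n α (∑ i, r i - m)) := by
  have hqm := mem_multiIndices.1 hq
  have hq0 : (0 : ℝ) < multiFactorial q := by exact_mod_cast multiFactorial_pos q
  have hinv : (multiFactorial q : ℝ≥0∞)⁻¹ = ENNReal.ofReal (multiFactorial q : ℝ)⁻¹ := by
    rw [ENNReal.ofReal_inv_of_pos hq0, ENNReal.ofReal_natCast]
  have hinj : Function.Injective fun p : Fin n → ℕ => p + q := fun p p' h => add_right_cancel h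
  rw [((h.taylorTail m).partialD q).bergmanNormSq_eq hα, ← ENNReal.tsum_mul_left,
    ← hinj.tsum_eq (f := fun r : Fin n → ℕ => ‖a r‖ₑ ^ 2 * ENNReal.ofReal (multiFactorial r *
        (∏ i, (r i).choose (q i) : ℕ) * bergmanConst n α (∑ i, r i - m)))]
  · refine tsum_congr fun p => ?_
    have hs : ∑ i, (p + q) i = ∑ i, p i + m := by simp [Finset.sum_add_distrib, hqm]
    have hreal : ((multiFactorial q : ℝ)⁻¹ * ((∏ i, ((p + q) i).descFactorial (q i) : ℕ) : ℝ) ^ 2) *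
        multiFactorial p = multiFactorial (p + q) * (∏ i, ((p + q) i).choose (q i) : ℕ) := by
      have := prod_descFactorial_sq_mul (p + q) q
      rw [add_tsub_cancel_right] at this
      rw [mul_assoc, inv_mul_eq_iff_eq_mul₀ hq0.ne']
      exact_mod_cast this
    rw [hs, if_neg (by omega), Nat.add_sub_cancel, enorm_mul, mul_pow, hinv, ← hreal]
    rw [mul_assoc (_ * _ : ℝ), ENNReal.ofReal_mul (p := _ * _ ^ 2) (by positivity),
      ENNReal.ofReal_mul (p := _⁻¹) (by positivity), ENNReal.ofReal_pow (by positivity),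
      ENNReal.ofReal_natCast]
    have : ‖((∏ i, (p i + q i).descFactorial (q i) : ℕ) : ℂ)‖ₑ =
        ((∏ i, ((p + q) i).descFactorial (q i) : ℕ) : ℝ≥0∞) := by
      rw [← ofReal_norm, Complex.norm_natCast, ENNReal.ofReal_natCast]
      rfl
    rw [this]
    ring
  · intro r hr
    by_contra hne
    refine hr ?_
    obtain ⟨i, hi⟩ : ∃ i, r i < q i := by
      by_contra hcon
      push Not at hcon
      exact hne ⟨r - q, tsub_add_cancel_of_le hcon⟩
    have : ∏ i, (r i).choose (q i) = 0 :=
      Finset.prod_eq_zero (Finset.mem_univ i) (Nat.choose_eq_zero_of_lt hi)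
    simp [this]

/-- The squared norm of order `m` in terms of Taylor coefficients. -/
lemma HasExpansion.normSq_eq {n : ℕ} (m : ℕ) {α : ℝ} (hα : -1 < α)
    {F : (Fin n → ℂ) → ℂ} {a : (Fin n → ℕ) → ℂ} (h : HasExpansion F a) :
    normSq m α F = ∑' p, ‖a p‖ₑ ^ 2 *
      ENNReal.ofReal (multiFactorial p * weight n m α (∑ i, p i)) := by
  have htail : (m ! : ℝ≥0∞) * ∑ q ∈ multiIndices n m, (multiFactorial q : ℝ≥0∞)⁻¹ *
      bergmanNormSq α (BergmanDirichlet.partialD q (BergmanDirichlet.taylorTail m F)) =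
      ∑' r : Fin n → ℕ, ‖a r‖ₑ ^ 2 * ENNReal.ofReal (multiFactorial r *
        ((∑ i, r i).descFactorial m * bergmanConst n α (∑ i, r i - m))) := by
    rw [Finset.sum_congr rfl fun q hq => h.bergmanNormSq_partialD hα hq,
      ← Summable.tsum_finsetSum fun _ _ => ENNReal.summable, ← ENNReal.tsum_mul_left]
    refine tsum_congr fun r => ?_
    have hB := (bergmanConst_pos n hα (∑ i, r i - m)).le
    -- For fixed `r`, Vandermonde sums the binomials to `|r|.choose m`, and `m!` turns this into a
    -- falling factorial.
    rw [← Finset.mul_sum, ← ENNReal.ofReal_sum_of_nonneg fun q _ => by positivity,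
      ← Finset.sum_mul, ← Finset.mul_sum, ← Nat.cast_sum, sum_multiIndices_prod_choose,
      Nat.descFactorial_eq_factorial_mul_choose, mul_left_comm, ← ENNReal.ofReal_natCast,
      ← ENNReal.ofReal_mul (by positivity)]
    congr 2
    push_cast
    ring
  rw [normSq, htail, (h.taylorHead m).bergmanNormSq_eq hα, ← ENNReal.tsum_add]
  refine tsum_congr fun p => ?_
  unfold weight
  split_ifs with hp
  -- Below degree `m` the falling factorial is zero and only the head contributes.
  · rw [Nat.descFactorial_of_lt hp]
    simp
  · simp

/-! ### The kernel as a power series in `⟨z, w⟩`. -/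

lemma norm_scal_lt_one {n : ℕ} {z w : Fin n → ℂ} (hz : z ∈ unitBall n) (hw : w ∈ unitBall n) :
    ‖scal z w‖ < 1 := by
  have hz := mem_unitBall.1 hz
  have hw := mem_unitBall.1 hw
  calc ‖scal z w‖ ≤ ∑ i, ‖z i * conj (w i)‖ := norm_sum_le _ _
    _ ≤ ∑ i, (‖z i‖ ^ 2 + ‖w i‖ ^ 2) / 2 := by
        gcongr with i
        rw [norm_mul, RCLike.norm_conj]
        nlinarith [sq_nonneg (‖z i‖ - ‖w i‖)]
    _ = (∑ i, ‖z i‖ ^ 2 + ∑ i, ‖w i‖ ^ 2) / 2 := by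
        rw [← Finset.sum_div, Finset.sum_add_distrib]
    _ < 1 := by linarith

lemma Gamma_add_nat_eq {a : ℝ} (ha : 0 < a) (k : ℕ) :
    Real.Gamma (a + k) = (ascPochhammer ℝ k).eval a * Real.Gamma a := by
  induction k with
  | zero => simp
  | succ k ih =>
    rw [ascPochhammer_succ_eval, Nat.cast_succ, ← add_assoc, Real.Gamma_add_one (by positivity), ih]
    ring

lemma ascPochhammer_eval_succ_nat (m j : ℕ) :
    (m ! : ℂ) * (ascPochhammer ℂ j).eval ((m : ℂ) + 1) = ((m + j)! : ℕ) := by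
  have h : (ascPochhammer ℂ j).eval ((m : ℂ) + 1) = ((m + 1).ascFactorial j : ℕ) := by
    rw [← ascPochhammer_nat_eq_ascFactorial, ascPochhammer_eval_cast]
    push_cast
    rfl
  rw [h, ← Nat.cast_mul, Nat.factorial_mul_ascFactorial]

lemma ascPochhammer_eval_ofReal (a : ℝ) (k : ℕ) :
    (ascPochhammer ℂ k).eval (a : ℂ) = ((ascPochhammer ℝ k).eval a : ℝ) := by
  induction k with
  | zero => simp
  | succ k ih => rw [ascPochhammer_succ_eval, ascPochhammer_succ_eval, ih]; push_cast; ring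

/-- Ratio test: the factor `((1 + j) / (m + 1 + j))²` is at most 1, and the remaining factor tends
to `‖x‖` in norm. -/
lemma summable_hypTerm (m : ℕ) {a : ℝ} (ha : 0 < a) {x : ℂ} (hx : ‖x‖ < 1) :
    Summable (hypTerm 1 1 a ((m : ℂ) + 1) ((m : ℂ) + 1) x) := by
  obtain ⟨r, hxr, hr1⟩ := exists_between hx
  have hlim : Filter.Tendsto (fun j : ℕ => (a + j) / (j + 1) * ‖x‖) Filter.atTop (nhds ‖x‖) := by
    have h1 : Filter.Tendsto (fun j : ℕ => (a + 1 * j) / (1 + 1 * (j : ℝ))) Filter.atTop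
        (nhds (1 / 1)) := tendsto_add_mul_div_add_mul_atTop_nhds a 1 1 one_ne_zero
    have := h1.mul_const ‖x‖
    simpa [add_comm] using this
  refine summable_of_ratio_norm_eventually_le hr1 ?_
  filter_upwards [hlim.eventually (gt_mem_nhds hxr)] with j hj
  have hb : ((m : ℂ) + 1 + j) ≠ 0 := by exact_mod_cast (show m + 1 + j ≠ 0 by omega)
  have hj1 : ((j : ℂ) + 1) ≠ 0 := by exact_mod_cast (show j + 1 ≠ 0 by omega)
  have hstep : hypTerm 1 1 a ((m : ℂ) + 1) ((m : ℂ) + 1) x (j + 1) =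
      ((1 + j) / (m + 1 + j)) ^ 2 * ((a + j) / (j + 1) * x) *
        hypTerm 1 1 a ((m : ℂ) + 1) ((m : ℂ) + 1) x j := by
    simp only [hypTerm, ascPochhammer_succ_eval, pow_succ, Nat.factorial_succ, Nat.cast_mul,
      Nat.cast_succ, pow_zero]
    simp only [div_eq_mul_inv, mul_inv]
    ring
  rw [hstep, norm_mul]
  gcongr
  rw [norm_mul, norm_pow]
  have h1 : ‖((1 : ℂ) + j) / (m + 1 + j)‖ ≤ 1 := by
    rw [norm_div, show (1 : ℂ) + j = ((1 + j : ℕ) : ℂ) by push_cast; ring,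
      show (m : ℂ) + 1 + j = ((m + 1 + j : ℕ) : ℂ) by push_cast; ring, Complex.norm_natCast,
      Complex.norm_natCast]
    refine div_le_one_of_le₀ ?_ (by positivity)
    exact_mod_cast (show 1 + j ≤ m + 1 + j by omega)
  have h2 : ‖((a : ℂ) + j) / (j + 1) * x‖ = (a + j) / (j + 1) * ‖x‖ := by
    rw [norm_mul, norm_div, show (a : ℂ) + j = ((a + j : ℝ) : ℂ) by push_cast; ring,
      show (j : ℂ) + 1 = ((j + 1 : ℝ) : ℂ) by push_cast; ring, Complex.norm_real,
      Complex.norm_real, Real.norm_of_nonneg (by positivity), Real.norm_of_nonneg (by positivity)]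
  rw [h2]
  refine le_trans ?_ hj.le
  exact mul_le_of_le_one_left (by positivity) (pow_le_one₀ (norm_nonneg _) h1)

lemma inv_bergmanConst (n : ℕ) {α : ℝ} (hα : -1 < α) (k : ℕ) :
    (bergmanConst n α k)⁻¹ = Real.Gamma (α + n + 1) / (Real.pi ^ n * Real.Gamma (α + 1)) *
      (ascPochhammer ℝ k).eval (α + n + 1) := by
  have h0 : 0 < α + n + 1 := by
    have : (0 : ℝ) ≤ n := by positivity
    linarith
  rw [bergmanConst, Gamma_add_nat_eq h0, inv_div]
  ring

/-- The kernel as a power series in `⟨z, w⟩`. -/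
lemma hasSum_kernelFormula {n : ℕ} (m : ℕ) {α : ℝ} (hα : -1 < α) {z w : Fin n → ℂ}
    (hz : z ∈ unitBall n) (hw : w ∈ unitBall n) :
    HasSum (fun k : ℕ => ((weight n m α k)⁻¹ : ℝ) * (scal z w ^ k / (k ! : ℂ)))
      (kernelFormula n m α z w) := by
  set x := scal z w
  have h0 : 0 < α + n + 1 := by
    have : (0 : ℝ) ≤ n := by positivity
    linarith
  have hs := (summable_hypTerm m h0 (norm_scal_lt_one hz hw)).hasSum
  -- The first `m` terms are the finite sum of the formula. With `k = m + j` and `a = α + n + 1`,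
  -- the coefficient becomes `K (a)ⱼ j! / ((m + j)!)²`, and `(m + j)! = m! (m + 1)ⱼ` makes it `K /
  -- (m!)²` times the hypergeometric one.
  rw [← hasSum_nat_add_iff' m]
  set K : ℝ := Real.Gamma (α + n + 1) / (Real.pi ^ n * Real.Gamma (α + 1))
  have hK : ((α : ℂ) + n + 1) = ((α + n + 1 : ℝ) : ℂ) := by push_cast; rfl
  have hsub : kernelFormula n m α z w -
      ∑ k ∈ Finset.range m, (((weight n m α k)⁻¹ : ℝ) : ℂ) * (x ^ k / (k ! : ℂ)) =
      K * (x ^ m / (m ! : ℂ) ^ 2) * ∑' j, hypTerm 1 1 ((α + n + 1 : ℝ) : ℂ) (m + 1) (m + 1) x j := by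
    have h1 : ∑ k ∈ Finset.range m, (((weight n m α k)⁻¹ : ℝ) : ℂ) * (x ^ k / (k ! : ℂ)) =
        K * ∑ k ∈ Finset.range m, (ascPochhammer ℂ k).eval ((α : ℂ) + n + 1) *
          (x ^ k / (k ! : ℂ)) := by
      rw [Finset.mul_sum]
      refine Finset.sum_congr rfl fun k hk => ?_
      rw [weight, if_pos (Finset.mem_range.1 hk), inv_bergmanConst n hα, hK,
        ascPochhammer_eval_ofReal, Complex.ofReal_mul, mul_assoc]
    rw [h1, kernelFormula, hyp3F2, hK]
    ring
  rw [hsub]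
  refine hasSum_of_forall_eq (hs.mul_left _) fun j => ?_
  have hmj : ((m + j)! : ℂ) ≠ 0 := Nat.cast_ne_zero.2 (Nat.factorial_ne_zero _)
  have hm : (m ! : ℂ) ≠ 0 := Nat.cast_ne_zero.2 (Nat.factorial_ne_zero _)
  have hj : (j ! : ℂ) ≠ 0 := Nat.cast_ne_zero.2 (Nat.factorial_ne_zero _)
  have hP : (ascPochhammer ℂ j).eval ((m : ℂ) + 1) = ((m + j)! : ℕ) / (m ! : ℂ) := by
    rw [eq_div_iff hm, mul_comm, ascPochhammer_eval_succ_nat]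
  have hd : ((j + m).descFactorial m : ℂ) = ((m + j)! : ℕ) / (j ! : ℂ) := by
    have := Nat.factorial_mul_descFactorial (Nat.le_add_left m j)
    rw [Nat.add_sub_cancel, add_comm j m] at this
    rw [eq_div_iff hj, mul_comm, add_comm j m]
    exact_mod_cast this
  rw [weight, if_neg (by omega), Nat.add_sub_cancel, mul_inv, inv_bergmanConst n hα, hypTerm,
    ascPochhammer_eval_one, hP, ascPochhammer_eval_ofReal]
  push_cast
  rw [hd, add_comm j m, pow_add]
  simp only [K, x]
  push_cast
  field_simp

/-- The sum of the degree `k` terms of the kernel. -/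
lemma sum_multiIndices_kernel {n : ℕ} (m : ℕ) (α : ℝ) (z w : Fin n → ℂ) (k : ℕ) :
    ∑ p ∈ multiIndices n k, monomial p z * conj (monomial p w) /
      ((multiFactorial p * weight n m α (∑ i, p i) : ℝ) : ℂ) =
      ((weight n m α k)⁻¹ : ℝ) * (scal z w ^ k / (k ! : ℂ)) := by
  rw [scal, Finset.sum_pow_eq_sum_piAntidiag, Finset.sum_div, Finset.mul_sum]
  refine Finset.sum_congr rfl fun p hp => ?_
  have hpk := mem_multiIndices.1 hp
  have hfac : (k ! : ℂ) = multiFactorial p * Nat.multinomial Finset.univ p := by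
    rw [← hpk, ← Nat.multinomial_spec, multiFactorial, Nat.cast_mul]
  have h1 : (multiFactorial p : ℂ) ≠ 0 := Nat.cast_ne_zero.2 (multiFactorial_pos p).ne'
  have h2 : (Nat.multinomial Finset.univ p : ℂ) ≠ 0 :=
    Nat.cast_ne_zero.2 (Nat.multinomial_pos _ _).ne'
  rw [hpk, hfac]
  simp only [monomial, map_prod, map_pow, mul_pow, Finset.prod_mul_distrib]
  push_cast
  -- Since `α` is unrestricted here, the weight may vanish; then both sides are 0 because division
  -- by zero gives 0.
  by_cases hw : (weight n m α k : ℂ) = 0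
  · simp [hw]
  · field_simp

/-- Point evaluations are bounded because of this. Grouped by degree, the sum is the convergent
kernel series at `(z, z)`, and nonnegative terms may be regrouped. -/
lemma summable_monomial_sq_div {n : ℕ} (m : ℕ) {α : ℝ} (hα : -1 < α) {z : Fin n → ℂ}
    (hz : z ∈ unitBall n) :
    Summable fun p : Fin n → ℕ =>
      ‖monomial p z‖ ^ 2 / (multiFactorial p * weight n m α (∑ i, p i)) := by
  classical
  set f : (Fin n → ℕ) → ℝ := fun p =>
    ‖monomial p z‖ ^ 2 / (multiFactorial p * weight n m α (∑ i, p i))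
  have hf0 : ∀ p, 0 ≤ f p := fun p => by
    have := weight_pos n m hα (∑ i, p i)
    positivity
  have hd : Summable fun k => ∑ p ∈ multiIndices n k, f p := by
    rw [← Complex.summable_ofReal]
    refine (hasSum_kernelFormula m hα hz hz).summable.congr fun k => ?_
    rw [← sum_multiIndices_kernel, Complex.ofReal_sum]
    refine Finset.sum_congr rfl fun p _ => ?_
    rw [Complex.mul_conj, Complex.normSq_eq_norm_sq, ← Complex.ofReal_div]
  refine summable_of_sum_le hf0 (c := ∑' k, ∑ p ∈ multiIndices n k, f p) fun u => ?_
  rw [← Finset.sum_fiberwise_of_maps_to (t := u.image fun p => ∑ i, p i)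
    (fun p hp => Finset.mem_image_of_mem _ hp)]
  refine (Finset.sum_le_sum fun k _ => ?_).trans
    (hd.sum_le_tsum _ fun k _ => Finset.sum_nonneg fun p _ => hf0 p)
  refine Finset.sum_le_sum_of_subset_of_nonneg (fun p hp => ?_) fun p _ _ => hf0 p
  exact mem_multiIndices.2 (Finset.mem_filter.1 hp).2

/-! ### The inner product -/

lemma aestronglyMeasurable_of_analytic {n : ℕ} (α : ℝ) {F : (Fin n → ℂ) → ℂ}
    (hF : AnalyticOnNhd ℂ F (unitBall n)) : AEStronglyMeasurable F (weightedMeasure n α) :=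
  (hF.continuousOn.aestronglyMeasurable (isOpen_unitBall n).measurableSet).mono_ac
    (withDensity_absolutelyContinuous _ _)

lemma memLp_two {n : ℕ} {α : ℝ} {F : (Fin n → ℂ) → ℂ} (hF : AnalyticOnNhd ℂ F (unitBall n))
    (h : bergmanNormSq α F < ∞) : MemLp F 2 (weightedMeasure n α) := by
  refine ⟨aestronglyMeasurable_of_analytic α hF, ?_⟩
  rw [eLpNorm_lt_top_iff_lintegral_rpow_enorm_lt_top two_ne_zero ENNReal.ofNat_ne_top]
  simpa [bergmanNormSq] using h

lemma integrable_mul_conj {n : ℕ} {α : ℝ} {F G : (Fin n → ℂ) → ℂ}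
    (hF : MemLp F 2 (weightedMeasure n α)) (hG : MemLp G 2 (weightedMeasure n α)) :
    Integrable (fun z => F z * conj (G z)) (weightedMeasure n α) :=
  hF.integrable_mul (q := 2) hG.star

lemma conj_bergmanInner {n : ℕ} (α : ℝ) (F G : (Fin n → ℂ) → ℂ) :
    conj (bergmanInner α F G) = bergmanInner α G F := by
  rw [bergmanInner, ← integral_conj]
  refine integral_congr_ae (Filter.Eventually.of_forall fun z => ?_)
  simp [mul_comm]

lemma bergmanInner_self {n : ℕ} {α : ℝ} {F : (Fin n → ℂ) → ℂ}
    (hF : AnalyticOnNhd ℂ F (unitBall n)) :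
    bergmanInner α F F = ((bergmanNormSq α F).toReal : ℂ) := by
  have h1 : bergmanInner α F F = ((∫ z, ‖F z‖ ^ 2 ∂weightedMeasure n α : ℝ) : ℂ) := by
    rw [bergmanInner, ← integral_complex_ofReal]
    refine integral_congr_ae (Filter.Eventually.of_forall fun z => ?_)
    simp only [Complex.mul_conj, Complex.normSq_eq_norm_sq]
  rw [h1, integral_eq_lintegral_of_nonneg_ae (Filter.Eventually.of_forall fun z => sq_nonneg _)
    ((aestronglyMeasurable_of_analytic α hF).norm.pow 2), bergmanNormSq]
  congr 3
  funext z
  rw [ENNReal.ofReal_pow (norm_nonneg _), ofReal_norm]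

lemma bergmanInner_add_right {n : ℕ} {α : ℝ} {T : ((Fin n → ℂ) → ℂ) → ((Fin n → ℂ) → ℂ)}
    (hT : IsLocalLinear T) {F G H : (Fin n → ℂ) → ℂ} (hF : AnalyticOnNhd ℂ F (unitBall n))
    (hG : AnalyticOnNhd ℂ G (unitBall n)) (hF2 : MemLp (T F) 2 (weightedMeasure n α))
    (hG2 : MemLp (T G) 2 (weightedMeasure n α)) (hH : MemLp H 2 (weightedMeasure n α)) :
    bergmanInner α H (T (F + G)) = bergmanInner α H (T F) + bergmanInner α H (T G) := by
  unfold bergmanInner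
  rw [← integral_add (integrable_mul_conj hH hF2) (integrable_mul_conj hH hG2)]
  refine integral_congr_ae ?_
  filter_upwards [ae_mem_unitBall n α] with z hz
  rw [hT.add F G hF hG hz, Pi.add_apply, map_add, mul_add]

lemma bergmanInner_smul_right {n : ℕ} {α : ℝ} {T : ((Fin n → ℂ) → ℂ) → ((Fin n → ℂ) → ℂ)}
    (hT : IsLocalLinear T) {F : (Fin n → ℂ) → ℂ} (hF : AnalyticOnNhd ℂ F (unitBall n)) (c : ℂ)
    (H : (Fin n → ℂ) → ℂ) :
    bergmanInner α H (T (c • F)) = conj c * bergmanInner α H (T F) := by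
  unfold bergmanInner
  rw [← integral_const_mul]
  refine integral_congr_ae ?_
  filter_upwards [ae_mem_unitBall n α] with z hz
  rw [hT.smul c F hF hz, Pi.smul_apply, smul_eq_mul, map_mul]
  ring

lemma isLocalLinear_partialD_taylorTail {n : ℕ} (m : ℕ) (q : Fin n → ℕ) :
    IsLocalLinear fun F => partialD q (taylorTail m F) :=
  (isLocalLinear_partialD q).comp (isLocalLinear_taylorTail m)

lemma bergmanNormSq_parts_lt_top {n m : ℕ} {α : ℝ} {F : (Fin n → ℂ) → ℂ}
    (h : normSq m α F < ∞) : bergmanNormSq α (taylorHead m F) < ∞ ∧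
      ∀ q ∈ multiIndices n m, bergmanNormSq α (partialD q (taylorTail m F)) < ∞ := by
  obtain ⟨h1, h2⟩ := ENNReal.add_lt_top.1 h
  refine ⟨h1, fun q hq => ?_⟩
  have h3 := ENNReal.lt_top_of_mul_ne_top_right h2.ne
    (Nat.cast_ne_zero.2 (Nat.factorial_ne_zero m))
  have h4 := ENNReal.sum_lt_top.1 h3 q hq
  exact ENNReal.lt_top_of_mul_ne_top_right h4.ne
    (ENNReal.inv_ne_zero.2 (ENNReal.natCast_ne_top _))

namespace Space

variable {n m : ℕ} {α : ℝ}

lemma analytic (f : Space n m α) : AnalyticOnNhd ℂ (zeroExt f.toFun) (unitBall n) := f.2.1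

lemma normSq_lt_top (f : Space n m α) : normSq m α (zeroExt f.toFun) < ∞ := f.2.2

lemma zeroExt_toFun_add (f g : Space n m α) :
    zeroExt (f + g).toFun = zeroExt f.toFun + zeroExt g.toFun :=
  zeroExt_add f.toFun g.toFun

lemma zeroExt_toFun_smul (c : ℂ) (f : Space n m α) :
    zeroExt (c • f).toFun = c • zeroExt f.toFun :=
  zeroExt_smul c f.toFun

lemma memLp_head (f : Space n m α) :
    MemLp (taylorHead m (zeroExt f.toFun)) 2 (weightedMeasure n α) :=
  memLp_two ((isLocalLinear_taylorHead m).analytic _ f.analytic)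
    (bergmanNormSq_parts_lt_top f.normSq_lt_top).1

lemma memLp_partialD (f : Space n m α) {q : Fin n → ℕ} (hq : q ∈ multiIndices n m) :
    MemLp (partialD q (taylorTail m (zeroExt f.toFun))) 2 (weightedMeasure n α) :=
  memLp_two ((isLocalLinear_partialD_taylorTail m q).analytic _ f.analytic)
    ((bergmanNormSq_parts_lt_top f.normSq_lt_top).2 q hq)

end Space

lemma zeroExt_apply {n : ℕ} (f : unitBall n → ℂ) (z : unitBall n) : zeroExt f z = f z :=
  Subtype.val_injective.extend_apply f 0 z

lemma innerProd_self {n m : ℕ} {α : ℝ} (f : Space n m α) :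
    innerProd m α (zeroExt f.toFun) (zeroExt f.toFun) =
      ((normSq m α (zeroExt f.toFun)).toReal : ℂ) := by
  have hfin := bergmanNormSq_parts_lt_top f.normSq_lt_top
  have hfin2 : ∀ q ∈ multiIndices n m, (multiFactorial q : ℝ≥0∞)⁻¹ *
      bergmanNormSq α (partialD q (taylorTail m (zeroExt f.toFun))) ≠ ∞ := fun q hq =>
    ENNReal.mul_ne_top (ENNReal.inv_ne_top.2 (Nat.cast_ne_zero.2 (multiFactorial_pos q).ne'))
      (hfin.2 q hq).ne
  rw [innerProd, normSq, ENNReal.toReal_add hfin.1.ne (ENNReal.mul_ne_top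
    (ENNReal.natCast_ne_top _) (ENNReal.sum_ne_top.2 hfin2)), ENNReal.toReal_mul,
    ENNReal.toReal_sum hfin2, bergmanInner_self ((isLocalLinear_taylorHead m).analytic _ f.analytic)]
  push_cast
  congr 2
  refine Finset.sum_congr rfl fun q _ => ?_
  rw [bergmanInner_self ((isLocalLinear_partialD_taylorTail m q).analytic _ f.analytic),
    ENNReal.toReal_mul, ENNReal.toReal_inv, ENNReal.toReal_natCast]
  push_cast
  rfl

lemma Space.hasExpansion {n m : ℕ} {α : ℝ} (f : Space n m α) :
    HasExpansion (zeroExt f.toFun) (taylorCoeff (zeroExt f.toFun)) := by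
  obtain ⟨a, ha⟩ := exists_hasExpansion f.analytic
  have : taylorCoeff (zeroExt f.toFun) = a := funext ha.taylorCoeff_eq
  rwa [this]

/-- The square of the norm of `z^p` in the space of order `m`. -/
def monomialNormSq {n : ℕ} (m : ℕ) (α : ℝ) (p : Fin n → ℕ) : ℝ :=
  multiFactorial p * weight n m α (∑ i, p i)

lemma monomialNormSq_pos {n : ℕ} (m : ℕ) {α : ℝ} (hα : -1 < α) (p : Fin n → ℕ) :
    0 < monomialNormSq m α p :=
  mul_pos (Nat.cast_pos.2 (multiFactorial_pos p)) (weight_pos n m hα _)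

lemma HasExpansion.normSq_eq_ofReal {n : ℕ} (m : ℕ) {α : ℝ} (hα : -1 < α)
    {F : (Fin n → ℂ) → ℂ} {a : (Fin n → ℕ) → ℂ} (h : HasExpansion F a) :
    normSq m α F = ∑' p, ENNReal.ofReal (‖((√(monomialNormSq m α p) : ℝ) : ℂ) * a p‖ ^ 2) := by
  rw [h.normSq_eq m hα]
  refine tsum_congr fun p => ?_
  have h0 := monomialNormSq_pos m hα p
  rw [norm_mul, mul_pow, Complex.norm_real, Real.norm_of_nonneg (Real.sqrt_nonneg _),
    Real.sq_sqrt h0.le, mul_comm, ENNReal.ofReal_mul h0.le, ENNReal.ofReal_pow (norm_nonneg _),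
    ofReal_norm]
  rfl

lemma Space.eq_zero_of_normSq_eq_zero {n m : ℕ} {α : ℝ} (hα : -1 < α) (f : Space n m α)
    (h : normSq m α (zeroExt f.toFun) = 0) : f = 0 := by
  rw [f.hasExpansion.normSq_eq_ofReal m hα, ENNReal.tsum_eq_zero] at h
  have hc : ∀ p, taylorCoeff (zeroExt f.toFun) p = 0 := by
    intro p
    have h1 := ENNReal.ofReal_eq_zero.1 (h p)
    have h2 := (pow_eq_zero_iff two_ne_zero).1 (le_antisymm h1 (sq_nonneg _))
    have h3 := (Real.sqrt_pos.2 (monomialNormSq_pos m hα p)).ne'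
    exact (mul_eq_zero.1 (norm_eq_zero.1 h2)).resolve_left (Complex.ofReal_ne_zero.2 h3)
  refine Subtype.ext (funext fun z => ?_)
  have := f.hasExpansion z z.2
  simp only [hc, zero_mul] at this
  rw [zeroExt_apply] at this
  exact this.unique hasSum_zero

/-- The inner product of the generalized Bergman-Dirichlet space. -/
@[reducible]
def innerCore {n : ℕ} (m : ℕ) {α : ℝ} (hα : -1 < α) :
    InnerProductSpace.Core ℂ (Space n m α) where
  inner f g := innerProd m α (zeroExt g.toFun) (zeroExt f.toFun)
  conj_inner_symm f g := by
    simp [innerProd, conj_bergmanInner]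
  re_inner_nonneg f := by
    rw [innerProd_self]
    simp
  add_left f g h := by
    rw [Space.zeroExt_toFun_add, innerProd, innerProd, innerProd,
      bergmanInner_add_right (isLocalLinear_taylorHead m) f.analytic g.analytic f.memLp_head
        g.memLp_head h.memLp_head,
      Finset.sum_congr rfl fun q hq => by
        rw [bergmanInner_add_right (isLocalLinear_partialD_taylorTail m q) f.analytic g.analytic
          (f.memLp_partialD hq) (g.memLp_partialD hq) (h.memLp_partialD hq), mul_add],
      Finset.sum_add_distrib]
    ring
  smul_left f g c := by
    rw [Space.zeroExt_toFun_smul, innerProd, innerProd,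
      bergmanInner_smul_right (isLocalLinear_taylorHead m) f.analytic,
      Finset.sum_congr rfl fun q _ => by
        rw [bergmanInner_smul_right (isLocalLinear_partialD_taylorTail m q) f.analytic,
          mul_left_comm],
      ← Finset.mul_sum]
    ring
  definite f h := by
    rw [innerProd_self, Complex.ofReal_eq_zero, ENNReal.toReal_eq_zero_iff] at h
    exact f.eq_zero_of_normSq_eq_zero hα (h.resolve_right f.normSq_lt_top.ne)

/-! ### The isometry with the space of square summable Taylor coefficients -/

/-- The square summable families indexed by multi-indices. -/
abbrev CoeffSpace (n : ℕ) : Type := lp (fun _ : Fin n → ℕ => ℂ) 2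

lemma memℓp_two_iff {n : ℕ} {c : (Fin n → ℕ) → ℂ} :
    Memℓp c 2 ↔ Summable fun p => ‖c p‖ ^ 2 := by
  rw [memℓp_gen_iff (by simp)]
  simp

lemma CoeffSpace.ofReal_norm_sq {n : ℕ} (c : CoeffSpace n) :
    ENNReal.ofReal (‖c‖ ^ 2) = ∑' p, ENNReal.ofReal (‖c p‖ ^ 2) := by
  have h := lp.hasSum_norm (p := 2) (by simp) c
  simp only [ENNReal.toReal_ofNat, Real.rpow_ofNat] at h
  rw [← h.tsum_eq, ENNReal.ofReal_tsum_of_nonneg (fun p => sq_nonneg _) h.summable]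

lemma memℓp_of_normSq_lt_top {n m : ℕ} {α : ℝ} (hα : -1 < α) (f : Space n m α) :
    Memℓp (fun p => ((√(monomialNormSq m α p) : ℝ) : ℂ) * taylorCoeff (zeroExt f.toFun) p) 2 := by
  have h := f.normSq_lt_top
  rw [f.hasExpansion.normSq_eq_ofReal m hα] at h
  refine memℓp_two_iff.2 ((ENNReal.summable_toReal h.ne).congr fun p => ?_)
  rw [ENNReal.toReal_ofReal (sq_nonneg _)]

lemma taylorCoeff_add {n : ℕ} {F G : (Fin n → ℂ) → ℂ} (hF : AnalyticOnNhd ℂ F (unitBall n))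
    (hG : AnalyticOnNhd ℂ G (unitBall n)) (p : Fin n → ℕ) :
    taylorCoeff (F + G) p = taylorCoeff F p + taylorCoeff G p := by
  rw [taylorCoeff, (isLocalLinear_partialD p).add F G hF hG (zero_mem_unitBall n), Pi.add_apply,
    add_div, taylorCoeff, taylorCoeff]

lemma taylorCoeff_smul {n : ℕ} {F : (Fin n → ℂ) → ℂ} (hF : AnalyticOnNhd ℂ F (unitBall n))
    (c : ℂ) (p : Fin n → ℕ) : taylorCoeff (c • F) p = c * taylorCoeff F p := by
  rw [taylorCoeff, (isLocalLinear_partialD p).smul c F hF (zero_mem_unitBall n), Pi.smul_apply,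
    smul_eq_mul, mul_div_assoc, taylorCoeff]

/-- The normalized Taylor coefficients of a function in the space. -/
def coeffMap {n : ℕ} (m : ℕ) {α : ℝ} (hα : -1 < α) : Space n m α →ₗ[ℂ] CoeffSpace n where
  toFun f := ⟨_, memℓp_of_normSq_lt_top hα f⟩
  map_add' f g := by
    ext p
    simp only [lp.coeFn_add, Pi.add_apply]
    rw [Space.zeroExt_toFun_add, taylorCoeff_add f.analytic g.analytic, mul_add]
  map_smul' c f := by
    ext p
    simp only [lp.coeFn_smul, Pi.smul_apply, smul_eq_mul, RingHom.id_apply]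
    rw [Space.zeroExt_toFun_smul, taylorCoeff_smul f.analytic, mul_left_comm]

lemma coeffMap_apply {n : ℕ} (m : ℕ) {α : ℝ} (hα : -1 < α) (f : Space n m α) (p : Fin n → ℕ) :
    coeffMap m hα f p = ((√(monomialNormSq m α p) : ℝ) : ℂ) * taylorCoeff (zeroExt f.toFun) p :=
  rfl

lemma ofReal_norm_coeffMap_sq {n : ℕ} (m : ℕ) {α : ℝ} (hα : -1 < α) (f : Space n m α) :
    ENNReal.ofReal (‖coeffMap m hα f‖ ^ 2) = normSq m α (zeroExt f.toFun) := by
  rw [CoeffSpace.ofReal_norm_sq, f.hasExpansion.normSq_eq_ofReal m hα]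
  rfl

/-- The normalized Taylor coefficients of the kernel function at `z`. -/
def kernelCoeff {n : ℕ} (m : ℕ) {α : ℝ} (hα : -1 < α) (z : unitBall n) : CoeffSpace n :=
  ⟨fun p => conj (monomial p z.1) / ((√(monomialNormSq m α p) : ℝ) : ℂ), by
    refine memℓp_two_iff.2 ((summable_monomial_sq_div m hα z.2).congr fun p => ?_)
    rw [norm_div, RCLike.norm_conj, div_pow, Complex.norm_real,
      Real.norm_of_nonneg (Real.sqrt_nonneg _), Real.sq_sqrt (monomialNormSq_pos m hα p).le]
    rfl⟩

lemma kernelCoeff_apply {n : ℕ} (m : ℕ) {α : ℝ} (hα : -1 < α) (z : unitBall n)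
    (p : Fin n → ℕ) : kernelCoeff m hα z p =
      conj (monomial p z.1) / ((√(monomialNormSq m α p) : ℝ) : ℂ) :=
  rfl

lemma sqrt_monomialNormSq_ne_zero {n : ℕ} (m : ℕ) {α : ℝ} (hα : -1 < α) (p : Fin n → ℕ) :
    ((√(monomialNormSq m α p) : ℝ) : ℂ) ≠ 0 :=
  Complex.ofReal_ne_zero.2 (Real.sqrt_pos.2 (monomialNormSq_pos m hα p)).ne'

/-- Valid for every square summable `c`, so it turns an arbitrary family into a power series that
converges on the whole ball. -/
lemma hasSum_inner_kernelCoeff {n : ℕ} (m : ℕ) {α : ℝ} (hα : -1 < α) (z : unitBall n)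
    (c : CoeffSpace n) :
    HasSum (fun p => c p / ((√(monomialNormSq m α p) : ℝ) : ℂ) * monomial p z.1)
      (inner ℂ (kernelCoeff m hα z) c) := by
  refine hasSum_of_forall_eq (lp.hasSum_inner (kernelCoeff m hα z) c) fun p => ?_
  rw [RCLike.inner_apply, kernelCoeff_apply, map_div₀, Complex.conj_conj, Complex.conj_ofReal]
  ring

lemma inner_kernelCoeff_coeffMap {n : ℕ} (m : ℕ) {α : ℝ} (hα : -1 < α) (z : unitBall n)
    (f : Space n m α) : inner ℂ (kernelCoeff m hα z) (coeffMap m hα f) = f.toFun z := by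
  refine (hasSum_inner_kernelCoeff m hα z _).unique ?_
  have h := f.hasExpansion z z.2
  rw [zeroExt_apply] at h
  refine hasSum_of_forall_eq h fun p => ?_
  rw [coeffMap_apply, mul_div_cancel_left₀ _ (sqrt_monomialNormSq_ne_zero m hα p)]

lemma inner_kernelCoeff {n : ℕ} (m : ℕ) {α : ℝ} (hα : -1 < α) (z w : unitBall n) :
    inner ℂ (kernelCoeff m hα z) (kernelCoeff m hα w) = kernelFormula n m α z.1 w.1 := by
  have h := hasSum_sum_multiIndices (hasSum_inner_kernelCoeff m hα z (kernelCoeff m hα w))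
  refine h.unique (hasSum_of_forall_eq (hasSum_kernelFormula m hα z.2 w.2) fun k => ?_)
  rw [← sum_multiIndices_kernel]
  refine Finset.sum_congr rfl fun p _ => ?_
  rw [kernelCoeff_apply, div_div, ← Complex.ofReal_mul,
    Real.mul_self_sqrt (monomialNormSq_pos m hα p).le, monomialNormSq]
  ring

/-- The preimage of `c` is `z ↦ ⟪kernelCoeff z, c⟫`: it is holomorphic as the sum of a power series,
and uniqueness of expansions returns `c`. -/
lemma coeffMap_surjective {n : ℕ} (m : ℕ) {α : ℝ} (hα : -1 < α) :
    Function.Surjective (coeffMap (n := n) m hα) := by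
  intro c
  set g : unitBall n → ℂ := fun z => inner ℂ (kernelCoeff m hα z) c
  set a : (Fin n → ℕ) → ℂ := fun p => c p / ((√(monomialNormSq m α p) : ℝ) : ℂ)
  have ha : HasExpansion (zeroExt g) a := fun z hz => by
    rw [show zeroExt g z = g ⟨z, hz⟩ from zeroExt_apply g ⟨z, hz⟩]
    exact hasSum_inner_kernelCoeff m hα ⟨z, hz⟩ c
  have hac : ∀ p, ((√(monomialNormSq m α p) : ℝ) : ℂ) * a p = c p := fun p =>
    mul_div_cancel₀ _ (sqrt_monomialNormSq_ne_zero m hα p)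
  have hfin : normSq m α (zeroExt g) < ∞ := by
    rw [ha.normSq_eq_ofReal m hα]
    simp only [hac]
    rw [← CoeffSpace.ofReal_norm_sq]
    exact ENNReal.ofReal_lt_top
  refine ⟨(⟨g, ha.analyticOnNhd, hfin⟩ : holSubmodule n m α), ?_⟩
  refine lp.ext (funext fun p => ?_)
  refine (coeffMap_apply m hα _ p).trans ((congrArg _ (ha.taylorCoeff_eq p)).trans (hac p))

end BergmanDirichlet

end
theorem theorem1 (n m : ℕ) (hn : 1 ≤ n) (α : ℝ) (hα : -1 < α) :
    -- the hypergeometric series converges at `⟨z, w⟩` for `z`, `w` in the ball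
    (∀ z w : BergmanDirichlet.unitBall n,
      Summable (BergmanDirichlet.hypTerm 1 1 ((α : ℂ) + n + 1) ((m : ℂ) + 1) ((m : ℂ) + 1)
        (BergmanDirichlet.scal z.1 w.1))) ∧
    -- `⟨·, ·⟩_{α,m}` is an inner product on the space (Mathlib's `inner` is linear in its
    -- second argument)
    ∃ core : InnerProductSpace.Core ℂ (BergmanDirichlet.Space n m α),
      (∀ f g : BergmanDirichlet.Space n m α,
        core.inner f g = BergmanDirichlet.innerProd m α (BergmanDirichlet.zeroExt g.toFun)
          (BergmanDirichlet.zeroExt f.toFun)) ∧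
      letI : NormedAddCommGroup (BergmanDirichlet.Space n m α) := core.toNormedAddCommGroup
      letI : InnerProductSpace ℂ (BergmanDirichlet.Space n m α) :=
        InnerProductSpace.ofCore core.toCore
      -- whose norm is `‖·‖_{α,m}`,
      (∀ f : BergmanDirichlet.Space n m α,
        ENNReal.ofReal (‖f‖ ^ 2) =
          BergmanDirichlet.normSq m α (BergmanDirichlet.zeroExt f.toFun)) ∧
      -- for which the space is complete, with continuous point evaluations,
      ∃ (_ : CompleteSpace (BergmanDirichlet.Space n m α))
        (_ : RKHS ℂ (BergmanDirichlet.Space n m α) (BergmanDirichlet.unitBall n) ℂ),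
        (∀ f : BergmanDirichlet.Space n m α, RKHS.coeCLM ℂ f = f.toFun) ∧
        -- and with the given reproducing kernel
        ∀ z w : BergmanDirichlet.unitBall n,
          RKHS.kernel (BergmanDirichlet.Space n m α) z w 1 =
            BergmanDirichlet.kernelFormula n m α z.1 w.1 := by
  open BergmanDirichlet in
  refine ⟨fun z w => ?_, innerCore m hα, fun f g => rfl, ?_⟩
  · have h0 : 0 < α + n + 1 := by
      have : (0 : ℝ) ≤ n := by positivity
      linarith
    have h := summable_hypTerm m h0 (norm_scal_lt_one z.2 w.2)
    push_cast at h
    exact h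
  let : NormedAddCommGroup (Space n m α) := (innerCore m hα).toNormedAddCommGroup
  let : InnerProductSpace ℂ (Space n m α) := InnerProductSpace.ofCore (innerCore m hα).toCore
  have hnorm : ∀ f : Space n m α, ENNReal.ofReal (‖f‖ ^ 2) = normSq m α (zeroExt f.toFun) := by
    intro f
    have h1 : ((‖f‖ ^ 2 : ℝ) : ℂ) = ((normSq m α (zeroExt f.toFun)).toReal : ℂ) := by
      rw [← innerProd_self f]
      push_cast
      exact (inner_self_eq_norm_sq_to_K (𝕜 := ℂ) f).symm
    rw [Complex.ofReal_injective h1, ENNReal.ofReal_toReal f.normSq_lt_top.ne]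
  -- Completeness and continuity of evaluations are transported from `ℓ²` along this isometry.
  let e : Space n m α ≃ₗᵢ[ℂ] CoeffSpace n := LinearIsometryEquiv.ofSurjective
    ⟨coeffMap m hα, fun f => by
      have h := (ofReal_norm_coeffMap_sq m hα f).trans (hnorm f).symm
      rw [ENNReal.ofReal_eq_ofReal_iff (sq_nonneg _) (sq_nonneg _)] at h
      exact (pow_left_inj₀ (norm_nonneg _) (norm_nonneg _) two_ne_zero).1 h⟩
    (coeffMap_surjective m hα)
  have he : ∀ f, e f = coeffMap m hα f := fun f => rfl
  have hcomplete : CompleteSpace (Space n m α) :=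
    (completeSpace_congr (e := e.toEquiv) e.isometry.isUniformEmbedding).2 inferInstance
  let E : Space n m α →L[ℂ] unitBall n → ℂ :=
    ContinuousLinearMap.pi fun z => (innerSL ℂ (kernelCoeff m hα z)).comp
      (e.toContinuousLinearEquiv : Space n m α →L[ℂ] CoeffSpace n)
  have hE : ∀ f, E f = f.toFun := fun f => funext fun z => inner_kernelCoeff_coeffMap m hα z f
  let R : RKHS ℂ (Space n m α) (unitBall n) ℂ :=
    ⟨E, fun f g hfg => Subtype.ext (by
      have h : E f = E g := hfg
      rw [hE, hE] at h
      exact h)⟩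
  refine ⟨hnorm, hcomplete, R, hE, fun z w => ?_⟩
  -- Both vectors represent evaluation at `w`, so they have the same inner product with every `f`.
  have hk : RKHS.kerFun (Space n m α) w 1 = e.symm (kernelCoeff m hα w) := by
    refine ext_inner_right ℂ fun f => ?_
    rw [RKHS.kerFun_inner, ← e.inner_map_map, e.apply_symm_apply, he,
      inner_kernelCoeff_coeffMap, RCLike.inner_apply, map_one, mul_one]
    exact congrFun (hE f) w
  rw [← RKHS.kerFun_apply, hk]
  have h : (e.symm (kernelCoeff m hα w)).toFun z = kernelFormula n m α z.1 w.1 := by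
    rw [← inner_kernelCoeff m hα, ← inner_kernelCoeff_coeffMap m hα, ← he, e.apply_symm_apply]
  rw [← h]
  exact congrFun (hE _) z
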